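/- Let $R$ be a ring with identity; "module" means left $R$-module. A graph $\Gamma=(A,V,s,t)$ consists of sets $A$ (arrows) and $V$ (vertices) and maps $s,t:A\to V$. An $R$-representation $F$ of $\Gamma$ consists of modules $F(v)$ $(v\in V)$ and homomorphisms $F(\gamma):F(s(\gamma))\to F(t(\gamma))$ $(\gamma\in A)$; it extends uniquely to a functor $\tilde F:W\Gamma\to Mod_R$ on the category $W\Gamma$ of paths in $\Gamma$. For $E\subseteq V$ let $\Phi(\Gamma,E;F)$ be the module of all finitely supported families $f=(f_\gamma)_{\gamma\in A}\in\bigoplus_{\gamma\in A}F(s(\gamma))$ such that $$\sum_{t(\gamma)=v}F(\gamma)(f_\gamma)-\sum_{s(\gamma)=v}f_\gamma=0\qquad\text{for all } v\in V\setminus E .$$ Let $\Phi_0(\Gamma;F)=\mathrm{colim}^{W\Gamma}\tilde F$. Let $\Gamma\cup_E pt$ be the graph obtained from $\Gamma$ by adding one vertex $*$ and, for each $e\in E$, one arrow $e\to *$; let $F\oplus_E 0$ be the representation of $\Gamma\cup_E pt$ which is $F$ on $\Gamma$ and $0$ at $*$, and put $\Phi_0(\Gamma,E;F)=\Phi_0(\Gamma\cup_E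 pt;F\oplus_E 0)$ (the obstruction module). Let $(I,\leqslant)$ be a partially ordered set, viewed as a category with a unique morphism $i\to j$ when $i\leqslant j$, and let $\mathrm{colim}_n^I$ be the $n$-th left derived functor of $\mathrm{colim}^I:Mod_R^I\to Mod_R$. A covering $X=\bigcup_{i\in I}X_i$ is locally filtered if $X_i\subseteq X_j$ whenever $i\leqslant j$, and if for all $i,j\in I$ and $x\in X_i\cap X_j$ there is $k\in I$ with $k\leqslant i$, $k\leqslant j$ and $x\in X_k\subseteq X_i\cap X_j$. **Theorem.** Let $\Gamma=(A,V,s,t)$ be a graph with subgraphs $\Gamma_i=(A_i,V_i,s_i,t_i)$, $i\in I$ (so $A_i\subseteq A$, $V_i\subseteq V$, and $s_i,t_i$ are the restrictions of $s,t$), such that $A=\bigcup_{i\in I}A_i$ and $V=\bigcup_{i\in I}V_i$ are locally filtered coverings. Let $E\subseteq V$ and $E_i\subseteq V_i$ be subsets such that $E=\bigcup_{i\in I}E_i$ is a locally filtered covering. Then for every $R$-representation $F$ of $\Gamma$, with restrictions $F_i=F|_{\Gamma_i}$, there is an exact sequence $$0\to \mathrm{colim}_2^I\{\Phi_0(\Gamma_i,E_i;F_i)\}\to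 \mathrm{colim}^I\{\Phi(\Gamma_i,E_i;F_i)\}\to \Phi(\Gamma,E;F)\to \mathrm{colim}_1^I\{\Phi_0(\Gamma_i,E_i;F_i)\}\to 0,$$ where the diagrams over $I$ are formed with the homomorphisms induced by the inclusions, and the middle homomorphism is the canonical one, induced by extending families by zero. -/

import Mathlib

open CategoryTheory CategoryTheory.Limits

universe u

noncomputable section

open scoped DirectSum Classical

/-! ### Left derived functors of the colimit -/

/-- Functors from a small category to `R`-modules have enough projectives. -/
instance functorModuleCat_enoughProjectives (C : Type u) [SmallCategory C] (R : Type u) [Ring R] :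
    EnoughProjectives (C ⥤ ModuleCat.{u} R) where
  presentation F := by
    have hp : ∀ c : C, Projective
        ((evaluationLeftAdjoint (ModuleCat.{u} R) c).obj (Projective.over (F.obj c))) := fun c =>
      (evaluationAdjunctionRight (ModuleCat.{u} R) c).map_projective _ inferInstance
    refine ⟨{
      p := ∐ fun c : C =>
        (evaluationLeftAdjoint (ModuleCat.{u} R) c).obj (Projective.over (F.obj c))
      projective := inferInstance
      f := Sigma.desc fun c => ((evaluationAdjunctionRight (ModuleCat.{u} R) c).homEquiv _ _).symm
        (Projective.π (F.obj c))
      epi := ⟨fun {G} g h w => ?_⟩ }⟩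
    refine NatTrans.ext (funext fun c => ?_)
    have w' := Sigma.ι (fun c : C =>
      (evaluationLeftAdjoint (ModuleCat.{u} R) c).obj (Projective.over (F.obj c))) c ≫= w
    rw [Sigma.ι_desc_assoc, Sigma.ι_desc_assoc, ← Adjunction.homEquiv_naturality_right_symm,
      ← Adjunction.homEquiv_naturality_right_symm] at w'
    exact (cancel_epi (Projective.π (F.obj c))).1 ((Equiv.injective _) w')

/-- The `n`-th left derived functor `colim_n^C` of the functor
`colim^C : (C ⥤ ModuleCat R) ⥤ ModuleCat R`. -/
def derivedColim (C : Type u) [SmallCategory C] (R : Type u) [Ring R] (n : ℕ) :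
    (C ⥤ ModuleCat.{u} R) ⥤ ModuleCat.{u} R :=
  (colim : (C ⥤ ModuleCat.{u} R) ⥤ ModuleCat.{u} R).leftDerived n

/-! ### Directed graphs, their path categories and representations -/

/-- A directed graph (loops and parallel arrows allowed): vertices, arrows, source and target. -/
structure DirGraph where
  /-- vertices -/
  V : Type u
  /-- arrows -/
  A : Type u
  /-- source -/
  s : A → V
  /-- target -/
  t : A → V

namespace DirGraph

/-- The arrows of `Γ`, sorted by source and target. -/
inductive Arrow (Γ : DirGraph.{u}) : Γ.V → Γ.V → Type u
  | mk (a : Γ.A) : Arrow Γ (Γ.s a) (Γ.t a)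

instance (Γ : DirGraph.{u}) : Quiver Γ.V := ⟨Γ.Arrow⟩

/-- The category `WΓ` of paths in `Γ`. -/
abbrev PathCat (Γ : DirGraph.{u}) : Type u := Paths Γ.V

/-- An `R`-representation of `Γ`. -/
structure Rep (R : Type u) [Ring R] (Γ : DirGraph.{u}) where
  /-- the module at a vertex -/
  obj : Γ.V → ModuleCat.{u} R
  /-- the homomorphism along an arrow -/
  map : ∀ a : Γ.A, obj (Γ.s a) ⟶ obj (Γ.t a)

variable {R : Type u} [Ring R] {Γ : DirGraph.{u}}

/-- The action of a representation on the arrows of the underlying quiver. -/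
def Rep.arrowMap (F : Rep R Γ) : ∀ {u v : Γ.V}, Γ.Arrow u v → (F.obj u ⟶ F.obj v)
  | _, _, .mk a => F.map a

/-- The functor `F̃ : WΓ ⥤ ModuleCat R` extending the representation `F`. -/
def Rep.functor (F : Rep R Γ) : Γ.PathCat ⥤ ModuleCat.{u} R :=
  Paths.lift { obj := F.obj, map := fun f => F.arrowMap f }

/-- The module of obstructions `Φ₀(Γ; F) = colim^{WΓ} F̃`. -/
def Rep.obstruction₀ (F : Rep R Γ) : ModuleCat.{u} R := colimit F.functor

/-- The graph `Γ ∪_E pt`: a new vertex `none` and, for every `e ∈ E`, a new arrow from `e` to it. -/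
def coneOff (Γ : DirGraph.{u}) (E : Set Γ.V) : DirGraph.{u} where
  V := Option Γ.V
  A := Γ.A ⊕ E
  s := Sum.elim (fun a => some (Γ.s a)) (fun e => some e.1)
  t := Sum.elim (fun a => some (Γ.t a)) (fun _ => none)

/-- The modules of the representation `F ⊕_E 0`. -/
def Rep.coneOffObj (F : Rep R Γ) : Option Γ.V → ModuleCat.{u} R
  | some v => F.obj v
  | none => ModuleCat.of R PUnit

/-- The representation `F ⊕_E 0` of `Γ ∪_E pt`: it is `F` on `Γ` and `0` at the new vertex. -/
def Rep.coneOff (F : Rep R Γ) (E : Set Γ.V) : Rep R (Γ.coneOff E) where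
  obj := F.coneOffObj
  map
    | .inl a => F.map a
    | .inr e => (0 : F.obj e.1 ⟶ ModuleCat.of R PUnit)

/-- The module of obstructions of the network `(Γ, E, F)`:
`Φ₀(Γ, E; F) = Φ₀(Γ ∪_E pt; F ⊕_E 0) = colim^{W(Γ ∪_E pt)} (F ⊕_E 0)~`. -/
def Rep.obstruction (F : Rep R Γ) (E : Set Γ.V) : ModuleCat.{u} R := (F.coneOff E).obstruction₀

/-! ### Chains and the first Kirchhoff law -/

/-- The module of `0`-chains `⨁_{v ∈ V} F(v)`. -/
abbrev Rep.Chain0 (F : Rep R Γ) : Type u := ⨁ v : Γ.V, F.obj v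

/-- The module of `1`-chains `⨁_{γ ∈ A} F(s(γ))`. -/
abbrev Rep.Chain1 (F : Rep R Γ) : Type u := ⨁ a : Γ.A, F.obj (Γ.s a)

/-- The boundary `d(x[γ]) = F(γ)(x)[t(γ)] - x[s(γ)]`, that is,
`(d f)_v = ∑_{t(γ) = v} F(γ)(f_γ) - ∑_{s(γ) = v} f_γ`. -/
def Rep.d (F : Rep R Γ) : F.Chain1 →ₗ[R] F.Chain0 :=
  DirectSum.toModule R Γ.A F.Chain0 fun a =>
    DirectSum.lof R Γ.V (fun v => F.obj v) (Γ.t a) ∘ₗ (F.map a).hom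
      - DirectSum.lof R Γ.V (fun v => F.obj v) (Γ.s a)

/-- `Φ(Γ, E; F)`: the module of `1`-chains which satisfy the first Kirchhoff law
`(d f)_v = 0` at every vertex `v ∉ E`. -/
def Rep.flows (F : Rep R Γ) (E : Set Γ.V) : Submodule R F.Chain1 where
  carrier := {f | ∀ v, v ∉ E → F.d f v = 0}
  add_mem' {f g} hf hg v hv := by
    rw [map_add, DirectSum.add_apply, hf v hv, hg v hv, add_zero]
  zero_mem' v _ := by rw [map_zero, DirectSum.zero_apply]
  smul_mem' r f hf v hv := by
    rw [map_smul, DirectSum.smul_apply, hf v hv, smul_zero]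

/-! ### Subgraphs -/

/-- A subgraph of `Γ`: subsets of `V` and `A` closed under the source and the target. -/
@[ext]
structure Sub (Γ : DirGraph.{u}) where
  /-- vertices of the subgraph -/
  verts : Set Γ.V
  /-- arrows of the subgraph -/
  arrows : Set Γ.A
  s_mem : ∀ a ∈ arrows, Γ.s a ∈ verts
  t_mem : ∀ a ∈ arrows, Γ.t a ∈ verts

/-- A subgraph as a graph. -/
def Sub.graph (H : Γ.Sub) : DirGraph.{u} where
  V := H.verts
  A := H.arrows
  s a := ⟨Γ.s a.1, H.s_mem a.1 a.2⟩
  t a := ⟨Γ.t a.1, H.t_mem a.1 a.2⟩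

/-- The restriction of a representation to a subgraph. -/
def Rep.restrict (F : Rep R Γ) (H : Γ.Sub) : Rep R H.graph where
  obj v := F.obj v.1
  map a := F.map a.1

/-- A set of vertices of `Γ`, seen as a set of vertices of the subgraph `H`. -/
def Sub.external (H : Γ.Sub) (E : Set Γ.V) : Set H.graph.V := {v | v.1 ∈ E}

/-! ### Maps induced by inclusions of subgraphs: obstructions -/

theorem Rep.arrowMap_comp (F : Rep R Γ) (M : ModuleCat.{u} R) (j : ∀ v, F.obj v ⟶ M)
    (hj : ∀ a, F.map a ≫ j (Γ.t a) = j (Γ.s a)) {x y : Γ.V} (f : Γ.Arrow x y) :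
    F.arrowMap f ≫ j y = j x := by
  cases f with
  | mk a => exact hj a

theorem Rep.functor_map_comp (F : Rep R Γ) (M : ModuleCat.{u} R) (j : ∀ v, F.obj v ⟶ M)
    (hj : ∀ a, F.map a ≫ j (Γ.t a) = j (Γ.s a)) {x y : Γ.V} (p : Quiver.Path x y) :
    (show F.obj x ⟶ F.obj y from F.functor.map p) ≫ j y = j x := by
  induction p with
  | nil => exact Category.id_comp _
  | cons p f ih =>
    refine Eq.trans (Category.assoc _ (F.arrowMap f) (j _)) ?_
    rw [F.arrowMap_comp M j hj]
    exact ih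

/-- A cocone on `F̃` from homomorphisms which are compatible along arrows. -/
def Rep.cocone (F : Rep R Γ) (M : ModuleCat.{u} R) (j : ∀ v, F.obj v ⟶ M)
    (hj : ∀ a, F.map a ≫ j (Γ.t a) = j (Γ.s a)) : Cocone F.functor where
  pt := M
  ι :=
    { app := fun v => j v
      naturality := fun {x y} p => by
        exact (F.functor_map_comp M j hj p).trans (Category.comp_id _).symm }

/-- The structural homomorphism `F(v) ⟶ Φ₀(Γ; F)` at a vertex `v`. -/
def Rep.toObstruction₀ (F : Rep R Γ) (v : Γ.V) : F.obj v ⟶ F.obstruction₀ :=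
  colimit.ι F.functor v

theorem Rep.map_toObstruction₀ (F : Rep R Γ) (a : Γ.A) :
    F.map a ≫ F.toObstruction₀ (Γ.t a) = F.toObstruction₀ (Γ.s a) := by
  have h := colimit.w F.functor
    (Quiver.Hom.toPath (V := Γ.V) (a := Γ.s a) (b := Γ.t a) (Arrow.mk a))
  have e : F.functor.map (Quiver.Hom.toPath (V := Γ.V) (a := Γ.s a) (b := Γ.t a) (Arrow.mk a)) =
    F.map a := Paths.lift_toPath _ _
  rw [e] at h
  exact h

/-- A family of homomorphisms compatible along arrows induces a homomorphism on `Φ₀(Γ; F)`. -/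
def Rep.obstruction₀Desc (F : Rep R Γ) {M : ModuleCat.{u} R} (j : ∀ v, F.obj v ⟶ M)
    (hj : ∀ a, F.map a ≫ j (Γ.t a) = j (Γ.s a)) : F.obstruction₀ ⟶ M :=
  colimit.desc F.functor (F.cocone M j hj)

theorem Rep.toObstruction₀_desc (F : Rep R Γ) {M : ModuleCat.{u} R} (j : ∀ v, F.obj v ⟶ M)
    (hj : ∀ a, F.map a ≫ j (Γ.t a) = j (Γ.s a)) (v : Γ.V) :
    F.toObstruction₀ v ≫ F.obstruction₀Desc j hj = j v :=
  colimit.ι_desc _ _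

theorem Rep.obstruction₀_hom_ext (F : Rep R Γ) {M : ModuleCat.{u} R} {f g : F.obstruction₀ ⟶ M}
    (h : ∀ v, F.toObstruction₀ v ≫ f = F.toObstruction₀ v ≫ g) : f = g :=
  colimit.hom_ext h

/-- For subgraphs `H ⊆ K` and `E ⊆ E'`, the inclusion of the vertices of `H ∪_E pt` into those of
`K ∪_{E'} pt`, at the level of modules. -/
def Rep.obstructionLeg (F : Rep R Γ) {H K : Γ.Sub} {E E' : Set Γ.V} (hV : H.verts ⊆ K.verts) :
    ∀ v : ((H.graph).coneOff (H.external E)).V,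
      ((F.restrict H).coneOff (H.external E)).obj v ⟶
        (F.restrict K).obstruction (K.external E')
  | some v => ((F.restrict K).coneOff (K.external E')).toObstruction₀ (some ⟨v.1, hV v.2⟩)
  | none => ((F.restrict K).coneOff (K.external E')).toObstruction₀ none

/-- The homomorphism `Φ₀(H, E; F|H) ⟶ Φ₀(K, E'; F|K)` induced by the inclusion
`H ∪_E pt ⊆ K ∪_{E'} pt`, for subgraphs `H ⊆ K` and `E ⊆ E'`. -/
def Rep.obstructionMap (F : Rep R Γ) {H K : Γ.Sub} {E E' : Set Γ.V}
    (hV : H.verts ⊆ K.verts) (hA : H.arrows ⊆ K.arrows) (hE : E ⊆ E') :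
    (F.restrict H).obstruction (H.external E) ⟶ (F.restrict K).obstruction (K.external E') :=
  ((F.restrict H).coneOff (H.external E)).obstruction₀Desc (F.obstructionLeg hV) <| by
    rintro (a | e)
    · exact ((F.restrict K).coneOff (K.external E')).map_toObstruction₀ (.inl ⟨a.1, hA a.2⟩)
    · exact ((F.restrict K).coneOff (K.external E')).map_toObstruction₀
        (.inr ⟨⟨e.1.1, hV e.1.2⟩, hE e.2⟩)

theorem Rep.toObstruction₀_obstructionMap (F : Rep R Γ) {H K : Γ.Sub} {E E' : Set Γ.V}
    (hV : H.verts ⊆ K.verts) (hA : H.arrows ⊆ K.arrows) (hE : E ⊆ E')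
    (v : ((H.graph).coneOff (H.external E)).V) :
    ((F.restrict H).coneOff (H.external E)).toObstruction₀ v ≫ F.obstructionMap hV hA hE =
      F.obstructionLeg hV v :=
  Rep.toObstruction₀_desc _ _ _ v

/-! ### Maps induced by inclusions of subgraphs: flows -/

/-- Extension by zero of finitely supported families along a map of index sets. -/
def extendFamily {ι κ : Type u} (ρ : ι → κ) (M : κ → ModuleCat.{u} R) :
    (⨁ i, M (ρ i)) →ₗ[R] ⨁ k, M k :=
  DirectSum.toModule R ι _ fun i => DirectSum.lof R κ (fun k => M k) (ρ i)

theorem extendFamily_lof {ι κ : Type u} (ρ : ι → κ) (M : κ → ModuleCat.{u} R) (i : ι)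
    (x : M (ρ i)) :
    extendFamily ρ M (DirectSum.lof R ι (fun i => M (ρ i)) i x) =
      DirectSum.lof R κ (fun k => M k) (ρ i) x :=
  DirectSum.toModule_lof (φ := fun i => DirectSum.lof R κ (fun k => M k) (ρ i)) R i x

theorem extendFamily_apply {ι κ : Type u} {ρ : ι → κ} (hρ : Function.Injective ρ)
    (M : κ → ModuleCat.{u} R) (x : ⨁ i, M (ρ i)) (i : ι) :
    extendFamily ρ M x (ρ i) = x i := by
  induction x using DirectSum.induction_on with
  | zero => simp
  | of j x =>
    have := extendFamily_lof ρ M j x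
    rw [DirectSum.lof_eq_of, DirectSum.lof_eq_of] at this
    rw [this]
    by_cases h : j = i
    · subst h
      rw [DirectSum.of_eq_same, DirectSum.of_eq_same]
    · rw [DirectSum.of_eq_of_ne _ _ _ (fun h' => h (hρ h').symm),
        DirectSum.of_eq_of_ne _ _ _ (fun h' => h h'.symm)]
  | add x y hx hy => rw [map_add, DirectSum.add_apply, DirectSum.add_apply, hx, hy]

theorem extendFamily_apply_of_not_mem {ι κ : Type u} {ρ : ι → κ}
    (M : κ → ModuleCat.{u} R) (x : ⨁ i, M (ρ i)) (k : κ) (hk : ∀ i, ρ i ≠ k) :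
    extendFamily ρ M x k = 0 := by
  induction x using DirectSum.induction_on with
  | zero => simp
  | of j x =>
    have := extendFamily_lof ρ M j x
    rw [DirectSum.lof_eq_of, DirectSum.lof_eq_of] at this
    rw [this, DirectSum.of_eq_of_ne _ _ _ (fun h' => hk j h'.symm)]
  | add x y hx hy => rw [map_add, DirectSum.add_apply, hx, hy, add_zero]

theorem extendFamily_id {κ : Type u} (M : κ → ModuleCat.{u} R) (x : ⨁ k, M k) :
    extendFamily (fun k => k) M x = x := by
  refine DFinsupp.ext fun k => ?_
  exact extendFamily_apply (ρ := fun k : κ => k) (fun _ _ h => h) M x k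

theorem extendFamily_comp {ι κ μ : Type u} (ρ : ι → κ) (σ : κ → μ) (M : μ → ModuleCat.{u} R)
    (x : ⨁ i, M (σ (ρ i))) :
    extendFamily σ M (extendFamily ρ (fun k => M (σ k)) x) =
      extendFamily (fun i => σ (ρ i)) M x := by
  induction x using DirectSum.induction_on with
  | zero => simp
  | of j x =>
    have h1 := extendFamily_lof ρ (fun k => M (σ k)) j x
    have h2 := extendFamily_lof σ M (ρ j) x
    have h3 := extendFamily_lof (fun i => σ (ρ i)) M j x
    rw [DirectSum.lof_eq_of] at h1 h2 h3
    rw [h1, h3, DirectSum.lof_eq_of, DirectSum.lof_eq_of, h2, DirectSum.lof_eq_of]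
  | add x y hx hy => rw [map_add, map_add, map_add, hx, hy]

/-- The inclusion of `1`-chains of a subgraph `H` into those of a subgraph `K ⊇ H`. -/
def Rep.chainMap (F : Rep R Γ) {H K : Γ.Sub} (hA : H.arrows ⊆ K.arrows) :
    (F.restrict H).Chain1 →ₗ[R] (F.restrict K).Chain1 :=
  extendFamily (fun a : H.arrows => (⟨a.1, hA a.2⟩ : K.arrows)) fun a => F.obj (Γ.s a.1)

/-- The inclusion of `1`-chains of a subgraph `H` into those of `Γ`. -/
def Rep.chainIncl (F : Rep R Γ) (H : Γ.Sub) : (F.restrict H).Chain1 →ₗ[R] F.Chain1 :=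
  extendFamily (fun a : H.arrows => a.1) fun a => F.obj (Γ.s a)

/-- The inclusion of `0`-chains of a subgraph `H` into those of a subgraph `K ⊇ H`. -/
def Rep.vertexMap (F : Rep R Γ) {H K : Γ.Sub} (hV : H.verts ⊆ K.verts) :
    (F.restrict H).Chain0 →ₗ[R] (F.restrict K).Chain0 :=
  extendFamily (fun v : H.verts => (⟨v.1, hV v.2⟩ : K.verts)) fun v => F.obj v.1

/-- The inclusion of `0`-chains of a subgraph `H` into those of `Γ`. -/
def Rep.vertexIncl (F : Rep R Γ) (H : Γ.Sub) : (F.restrict H).Chain0 →ₗ[R] F.Chain0 :=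
  extendFamily (fun v : H.verts => v.1) fun v => F.obj v

theorem Rep.d_lof (F : Rep R Γ) (a : Γ.A) (x : F.obj (Γ.s a)) :
    F.d (DirectSum.lof R Γ.A (fun a => F.obj (Γ.s a)) a x) =
      DirectSum.lof R Γ.V (fun v => F.obj v) (Γ.t a) ((F.map a).hom x)
        - DirectSum.lof R Γ.V (fun v => F.obj v) (Γ.s a) x := by
  unfold Rep.d
  rw [DirectSum.toModule_lof]
  rfl

theorem Rep.d_chainMap (F : Rep R Γ) {H K : Γ.Sub}
    (hV : H.verts ⊆ K.verts) (hA : H.arrows ⊆ K.arrows) :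
    (F.restrict K).d ∘ₗ F.chainMap hA = F.vertexMap hV ∘ₗ (F.restrict H).d := by
  refine DirectSum.linearMap_ext R fun a => LinearMap.ext fun x => ?_
  have h1 := extendFamily_lof (fun a : H.arrows => (⟨a.1, hA a.2⟩ : K.arrows))
    (fun a => F.obj (Γ.s a.1)) a x
  have h2 := extendFamily_lof (fun v : H.verts => (⟨v.1, hV v.2⟩ : K.verts))
    (fun v => F.obj v.1) (H.graph.t a) ((F.map a.1).hom x)
  have h3 := extendFamily_lof (fun v : H.verts => (⟨v.1, hV v.2⟩ : K.verts))
    (fun v => F.obj v.1) (H.graph.s a) x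
  refine (congrArg (F.restrict K).d h1).trans ?_
  refine ((F.restrict K).d_lof ⟨a.1, hA a.2⟩ x).trans ?_
  refine Eq.trans ?_ (congrArg (F.vertexMap hV) ((F.restrict H).d_lof a x)).symm
  rw [map_sub]
  exact (congrArg₂ (· - ·) h2 h3).symm

theorem Rep.d_chainIncl (F : Rep R Γ) (H : Γ.Sub) :
    F.d ∘ₗ F.chainIncl H = F.vertexIncl H ∘ₗ (F.restrict H).d := by
  refine DirectSum.linearMap_ext R fun a => LinearMap.ext fun x => ?_
  have h1 := extendFamily_lof (fun a : H.arrows => a.1) (fun a => F.obj (Γ.s a)) a x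
  have h2 := extendFamily_lof (fun v : H.verts => v.1)
    (fun v => F.obj v) (H.graph.t a) ((F.map a.1).hom x)
  have h3 := extendFamily_lof (fun v : H.verts => v.1) (fun v => F.obj v) (H.graph.s a) x
  refine (congrArg F.d h1).trans ?_
  refine (F.d_lof a.1 x).trans ?_
  refine Eq.trans ?_ (congrArg (F.vertexIncl H) ((F.restrict H).d_lof a x)).symm
  rw [map_sub]
  exact (congrArg₂ (· - ·) h2 h3).symm

theorem Rep.chainMap_mem_flows (F : Rep R Γ) {H K : Γ.Sub} {E E' : Set Γ.V}
    (hV : H.verts ⊆ K.verts) (hA : H.arrows ⊆ K.arrows) (hE : E ⊆ E')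
    (f : (F.restrict H).Chain1) (hf : f ∈ (F.restrict H).flows (H.external E)) :
    F.chainMap hA f ∈ (F.restrict K).flows (K.external E') := by
  intro v hv
  have h : (F.restrict K).d (F.chainMap hA f) = F.vertexMap hV ((F.restrict H).d f) :=
    LinearMap.congr_fun (F.d_chainMap hV hA) f
  rw [h]
  by_cases hvH : v.1 ∈ H.verts
  · have hinj : Function.Injective fun v : H.verts => (⟨v.1, hV v.2⟩ : K.verts) :=
      fun x y hxy => Subtype.ext (Subtype.mk.inj hxy)
    refine (extendFamily_apply hinj (fun v => F.obj v.1) ((F.restrict H).d f) ⟨v.1, hvH⟩).trans ?_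
    exact hf ⟨v.1, hvH⟩ fun h' => hv (hE h')
  · refine extendFamily_apply_of_not_mem
      (ρ := fun v : H.verts => (⟨v.1, hV v.2⟩ : K.verts)) (fun v => F.obj v.1)
      ((F.restrict H).d f) v fun w hw => hvH ?_
    rw [← hw]
    exact w.2

theorem Rep.chainIncl_mem_flows (F : Rep R Γ) {H : Γ.Sub} {E E' : Set Γ.V} (hE : E ⊆ E')
    (f : (F.restrict H).Chain1) (hf : f ∈ (F.restrict H).flows (H.external E)) :
    F.chainIncl H f ∈ F.flows E' := by
  intro v hv
  have h : F.d (F.chainIncl H f) = F.vertexIncl H ((F.restrict H).d f) :=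
    LinearMap.congr_fun (F.d_chainIncl H) f
  rw [h]
  by_cases hvH : v ∈ H.verts
  · refine (extendFamily_apply Subtype.val_injective (fun v => F.obj v) ((F.restrict H).d f)
      ⟨v, hvH⟩).trans ?_
    exact hf ⟨v, hvH⟩ fun h' => hv (hE h')
  · refine extendFamily_apply_of_not_mem
      (ρ := fun v : H.verts => v.1) (fun v => F.obj v)
      ((F.restrict H).d f) v fun w hw => hvH ?_
    rw [← hw]
    exact w.2

/-- The homomorphism `Φ(H, E; F|H) → Φ(K, E'; F|K)` extending flows by zero,
for subgraphs `H ⊆ K` and `E ⊆ E'`. -/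
def Rep.flowsMap (F : Rep R Γ) {H K : Γ.Sub} {E E' : Set Γ.V}
    (hV : H.verts ⊆ K.verts) (hA : H.arrows ⊆ K.arrows) (hE : E ⊆ E') :
    (F.restrict H).flows (H.external E) →ₗ[R] (F.restrict K).flows (K.external E') :=
  (F.chainMap hA).restrict (F.chainMap_mem_flows hV hA hE)

/-- The homomorphism `Φ(H, E; F|H) → Φ(Γ, E'; F)` extending flows by zero,
for a subgraph `H` of `Γ` and `E ⊆ E'`. -/
def Rep.flowsIncl (F : Rep R Γ) (H : Γ.Sub) {E E' : Set Γ.V} (hE : E ⊆ E') :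
    (F.restrict H).flows (H.external E) →ₗ[R] F.flows E' :=
  (F.chainIncl H).restrict (F.chainIncl_mem_flows hE)

/-! ### Locally filtered coverings and the associated diagrams -/

/-- `X = ⋃ i, Y i` is a locally filtered covering: `Y` is monotone, and any point of
`Y i ∩ Y j` lies in some `Y k ⊆ Y i ∩ Y j` with `k ≤ i` and `k ≤ j`. -/
structure IsLocallyFilteredCovering {I : Type u} [PartialOrder I] {T : Type u}
    (X : Set T) (Y : I → Set T) : Prop where
  mono : ∀ i j, i ≤ j → Y i ⊆ Y j
  iUnion_eq : X = ⋃ i, Y i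
  exists_le : ∀ i j, ∀ x ∈ Y i ∩ Y j, ∃ k, k ≤ i ∧ k ≤ j ∧ x ∈ Y k ∧ Y k ⊆ Y i ∩ Y j

variable {I : Type u} [PartialOrder I]

/-- The network `(Γ, E)` is locally filtered covered by the networks `(Γ_i, E_i)`, `i ∈ I`, where
`Γ_i` is a subgraph of `Γ` and `E_i` is a set of vertices of `Γ_i`. -/
structure LocallyFilteredCover (Γ : DirGraph.{u}) (E : Set Γ.V) (I : Type u) [PartialOrder I] where
  /-- the subgraphs `Γ_i` -/
  sub : I → Γ.Sub
  /-- the external vertices `E_i` of `Γ_i` -/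
  external : I → Set Γ.V
  external_subset : ∀ i, external i ⊆ (sub i).verts
  verts_cover : IsLocallyFilteredCovering Set.univ fun i => (sub i).verts
  arrows_cover : IsLocallyFilteredCovering Set.univ fun i => (sub i).arrows
  external_cover : IsLocallyFilteredCovering E external

namespace LocallyFilteredCover

variable {E : Set Γ.V} (𝒞 : LocallyFilteredCover Γ E I) (F : Rep R Γ)

/-- The diagram `i ↦ Φ₀(Γ_i, E_i; F_i)` with the homomorphisms induced by the inclusions. -/
def obstructionDiagram : I ⥤ ModuleCat.{u} R where
  obj i := (F.restrict (𝒞.sub i)).obstruction ((𝒞.sub i).external (𝒞.external i))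
  map {i j} h := F.obstructionMap (𝒞.verts_cover.mono i j h.le) (𝒞.arrows_cover.mono i j h.le)
    (𝒞.external_cover.mono i j h.le)
  map_id i := by
    refine Rep.obstruction₀_hom_ext _ fun v => ?_
    refine (Rep.toObstruction₀_desc _ _ _ v).trans ?_
    refine Eq.trans ?_ (Category.comp_id _).symm
    cases v <;> rfl
  map_comp {i j k} h h' := by
    refine Rep.obstruction₀_hom_ext _ fun v => ?_
    refine (Rep.toObstruction₀_desc _ _ _ v).trans ?_
    refine Eq.trans ?_ (Category.assoc _ _ _)
    refine Eq.trans ?_ (congrArg (· ≫ _) (Rep.toObstruction₀_desc _ _ _ v)).symm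
    rcases v with _ | v
    · exact (F.toObstruction₀_obstructionMap (𝒞.verts_cover.mono j k h'.le)
        (𝒞.arrows_cover.mono j k h'.le) (𝒞.external_cover.mono j k h'.le) none).symm
    · exact (F.toObstruction₀_obstructionMap (𝒞.verts_cover.mono j k h'.le)
        (𝒞.arrows_cover.mono j k h'.le) (𝒞.external_cover.mono j k h'.le)
        (some ⟨v.1, 𝒞.verts_cover.mono i j h.le v.2⟩)).symm

/-- The diagram `i ↦ Φ(Γ_i, E_i; F_i)` with the homomorphisms extending flows by zero. -/
def flowsDiagram : I ⥤ ModuleCat.{u} R where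
  obj i := ModuleCat.of R ((F.restrict (𝒞.sub i)).flows ((𝒞.sub i).external (𝒞.external i)))
  map {i j} h := ModuleCat.ofHom <| F.flowsMap (𝒞.verts_cover.mono i j h.le)
    (𝒞.arrows_cover.mono i j h.le) (𝒞.external_cover.mono i j h.le)
  map_id i := by
    refine ModuleCat.hom_ext (LinearMap.ext fun f => Subtype.ext ?_)
    exact extendFamily_id (fun a : (𝒞.sub i).arrows => F.obj (Γ.s a.1)) f.1
  map_comp {i j k} h h' := by
    refine ModuleCat.hom_ext (LinearMap.ext fun f => Subtype.ext ?_)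
    exact (extendFamily_comp
      (fun a : (𝒞.sub i).arrows =>
        (⟨a.1, 𝒞.arrows_cover.mono i j h.le a.2⟩ : (𝒞.sub j).arrows))
      (fun a : (𝒞.sub j).arrows =>
        (⟨a.1, 𝒞.arrows_cover.mono j k h'.le a.2⟩ : (𝒞.sub k).arrows))
      (fun a => F.obj (Γ.s a.1)) f.1).symm

/-- The homomorphisms `Φ(Γ_i, E_i; F_i) ⟶ Φ(Γ, E; F)` extending flows by zero. -/
def flowsCocone : Cocone (𝒞.flowsDiagram F) where
  pt := ModuleCat.of R (F.flows E)
  ι :=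
    { app := fun i => ModuleCat.ofHom <| F.flowsIncl (𝒞.sub i) <|
        (Set.subset_iUnion 𝒞.external i).trans_eq 𝒞.external_cover.iUnion_eq.symm
      naturality := fun {i j} h => by
        refine ModuleCat.hom_ext (LinearMap.ext fun f => Subtype.ext ?_)
        exact extendFamily_comp
          (fun a : (𝒞.sub i).arrows =>
            (⟨a.1, 𝒞.arrows_cover.mono i j h.le a.2⟩ : (𝒞.sub j).arrows))
          (fun a : (𝒞.sub j).arrows => a.1) (fun a => F.obj (Γ.s a)) f.1 }

/-- The canonical homomorphism `colim^I Φ(Γ_i, E_i; F_i) ⟶ Φ(Γ, E; F)`. -/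
def flowsColimitMap : colimit (𝒞.flowsDiagram F) ⟶ ModuleCat.of R (F.flows E) :=
  colimit.desc _ (𝒞.flowsCocone F)

end LocallyFilteredCover

end DirGraph

end

/-! Relative `1`-chains put the flows and the obstructions of a network into one two-term complex.
Let `C₁` be the direct sum of the `F(s(γ))` over arrows and of the `F(e)` over external vertices,
let `C₀` be the direct sum of the `F(v)`, and let `(f, g) ↦ d f + g` be the boundary. A cycle is a
pair `(f, -d f)` with `d f` supported in `E`, so the kernel is `Φ`. The cokernel kills external
vertices and identifies `x` with `F(γ)(x)` along each arrow, so it is `Φ₀`. With `B` the image, the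
cover gives exact sequences of diagrams `0 → Φ → C₁ → B → 0` and `0 → B → C₀ → Φ₀ → 0`
(`flows_shortExact`, `obstruction_shortExact`).

The diagrams `C₁` and `C₀` consist of families supported in a monotone system of sets. Of the
covering hypothesis only this is used besides monotonicity and the union: two indices whose sets
contain `x` have a common lower bound whose set contains `x`. It implies that the colimit embeds in
the global direct sum (`supportColimitMap_injective`) and that `colim_1` and `colim_2` vanish
(`supportDiagram_isZero_one`, `supportDiagram_isZero_two`).

The second sequence then gives `colim_2 Φ₀ ≅ colim_1 B` and identifies `colim_1 Φ₀` with the kernel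
of `colim B → colim C₀`. The first gives `0 → colim_1 B → colim Φ → colim C₁ → colim B → 0`. Inside
the global relative chains, `Φ(Γ, E; F)` is the kernel of `colim C₁ → colim C₀`
(`boundary_eq_zero_iff`). Hence the canonical map has kernel `colim_1 B` and cokernel `ker (colim B
→ colim C₀)`, as claimed.

For the vanishing, suppose first that each point `x` is born at a single index `b x`. Such a
principal diagram is projective when its modules are, and covering general modules by projectives
shows that it is acyclic. In general, finitely many families involve finitely many points, and each
point can be given a birth index below all the relevant indices; so every finite set of elements
lies in a principal subdiagram. Vanishing passes from these subdiagrams to the whole, because an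
element of a colimit involves finitely many elements of the diagram
(`FinitelyApproximated.isZero_one`). -/

noncomputable section

open scoped DirectSum Classical

/-! ### Dimension shifting for left derived functors -/

section DimensionShift

universe v₁ u₁ v₂ u₂

variable {C : Type u₁} [Category.{v₁} C] [Abelian C]

/-- The augmentation of a projective resolution, as a morphism in the abelian category. -/
def CategoryTheory.ProjectiveResolution.augmentation {X : C} (Q : ProjectiveResolution X) :
    Q.complex.X 0 ⟶ X := Q.π.f 0

theorem CategoryTheory.ProjectiveResolution.d_augmentation {X : C} (Q : ProjectiveResolution X) :
    Q.complex.d 1 0 ≫ Q.augmentation = 0 := Q.complex_d_comp_π_f_zero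

instance CategoryTheory.ProjectiveResolution.epi_augmentation {X : C}
    (Q : ProjectiveResolution X) : Epi Q.augmentation := inferInstanceAs (Epi (Q.π.f 0))

/-- The augmentation of a projective resolution is a cokernel of the first differential. -/
def CategoryTheory.ProjectiveResolution.isColimitAugmentation {X : C}
    (Q : ProjectiveResolution X) :
    IsColimit (CokernelCofork.ofπ Q.augmentation Q.d_augmentation) :=
  Q.isColimitCokernelCofork

theorem CategoryTheory.ProjectiveResolution.d_augmentation_comp {X Y : C}
    (Q : ProjectiveResolution X) (f : X ⟶ Y) : Q.complex.d 1 0 ≫ Q.augmentation ≫ f = 0 := by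
  rw [← Category.assoc, Q.d_augmentation, zero_comp]

/-- Splicing a projective resolution of the kernel of an epimorphism from a projective object with
that epimorphism. -/
def CategoryTheory.ProjectiveResolution.splice {S : ShortComplex C} (hS : S.ShortExact)
    [Projective S.X₂] (Q : ProjectiveResolution S.X₁) : ProjectiveResolution S.X₃ where
  complex := Q.complex.augment (Q.augmentation ≫ S.f) (Q.d_augmentation_comp _)
  projective n := by
    rcases n with _ | n
    · exact inferInstanceAs (Projective S.X₂)
    · exact Q.projective n
  π := (ChainComplex.toSingle₀Equiv _ _).symm ⟨S.g, by
    exact (Category.assoc _ _ _).trans ((congrArg (Q.augmentation ≫ ·) S.zero).trans comp_zero)⟩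
  quasiIso := ⟨fun n => by
    have := hS.epi_g
    have := hS.mono_f
    rcases n with _ | _ | n
    -- Degree `0`: the sequence through `Q.augmentation ≫ S.f` inherits exactness from `S`, since
    -- the augmentation is epi.
    · rw [ChainComplex.quasiIsoAt₀_iff, ShortComplex.quasiIso_iff_of_zeros']
      · have h0 : (Q.augmentation ≫ S.f) ≫ S.g = 0 := by rw [Category.assoc, S.zero, comp_zero]
        have h : (ShortComplex.mk (Q.augmentation ≫ S.f) S.g h0).Exact := by
          let φ : ShortComplex.mk (Q.augmentation ≫ S.f) S.g h0 ⟶ S :=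
            { τ₁ := Q.augmentation, τ₂ := 𝟙 _, τ₃ := 𝟙 _ }
          have : Epi φ.τ₁ := inferInstanceAs (Epi Q.augmentation)
          have : IsIso φ.τ₂ := inferInstanceAs (IsIso (𝟙 _))
          have : Mono φ.τ₃ := inferInstanceAs (Mono (𝟙 _))
          exact (ShortComplex.exact_iff_of_epi_of_isIso_of_mono φ).2 hS.exact
        refine (ShortComplex.exact_and_epi_g_iff_of_iso ?_).2 ⟨h, hS.epi_g⟩
        exact ShortComplex.isoMk (Iso.refl _) (Iso.refl _) (Iso.refl _)
          ((Category.id_comp _).trans (Category.comp_id _).symm)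
          ((Category.id_comp _).trans ((ChainComplex.toSingle₀Equiv_symm_apply_f_zero
            (C := Q.complex.augment _ (Q.d_augmentation_comp S.f)) S.g _).symm.trans
              (Category.comp_id _).symm))
      all_goals rfl
    -- Degree `1`: composing the augmentation with the mono `S.f` does not change its kernel. Higher
    -- degrees are those of `Q`, shifted by one.
    · rw [quasiIsoAt_iff_exactAt' _ _ (ChainComplex.exactAt_succ_single_obj _ _),
        HomologicalComplex.exactAt_iff' _ 2 1 0 (by simp) (by simp)]
      have h : (ShortComplex.mk _ _ Q.d_augmentation).Exact :=
        ShortComplex.exact_of_g_is_cokernel _ Q.isColimitAugmentation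
      let φ : ShortComplex.mk _ _ Q.d_augmentation ⟶
          ShortComplex.mk _ _ (Q.d_augmentation_comp S.f) :=
        { τ₁ := 𝟙 _, τ₂ := 𝟙 _, τ₃ := S.f }
      have : Epi φ.τ₁ := inferInstanceAs (Epi (𝟙 _))
      have : IsIso φ.τ₂ := inferInstanceAs (IsIso (𝟙 _))
      have : Mono φ.τ₃ := hS.mono_f
      exact (ShortComplex.exact_iff_of_epi_of_isIso_of_mono φ).1 h
    · rw [quasiIsoAt_iff_exactAt' _ _ (ChainComplex.exactAt_succ_single_obj _ _),
        HomologicalComplex.exactAt_iff' _ (n + 3) (n + 2) (n + 1) (by simp) (by simp)]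
      exact Q.exact_succ n⟩

variable [HasProjectiveResolutions C] {D : Type u₂} [Category.{v₂} D] [Abelian D]
  (F : C ⥤ D) [F.Additive]

/-- In the spliced resolution of `S.X₃` the terms and differentials around degree `2` are those of
`Q` around degree `1`, so the two homologies agree on the nose. -/
theorem leftDerived_two_iso_of_projective {S : ShortComplex C} (hS : S.ShortExact)
    [Projective S.X₂] : Nonempty ((F.leftDerived 2).obj S.X₃ ≅ (F.leftDerived 1).obj S.X₁) := by
  let Q := projectiveResolution S.X₁
  let P := ProjectiveResolution.splice hS Q
  refine ⟨P.isoLeftDerivedObj F 2 ≪≫ ?_ ≪≫ (Q.isoLeftDerivedObj F 1).symm⟩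
  refine ((F.mapHomologicalComplex _).obj P.complex).homologyIsoSc' 3 2 1 (by simp) (by simp) ≪≫ ?_
  refine ?_ ≪≫ (((F.mapHomologicalComplex _).obj Q.complex).homologyIsoSc' 2 1 0
    (by simp) (by simp)).symm
  exact Iso.refl _

/-- Degree `1` of the spliced complex is `F Q₁ → F Q₀ → F S.X₂`. By right exactness the cokernel of
the first map is `F S.X₁`, and the map it induces to `F S.X₂` is `F.map S.f`; the homology is its
kernel. -/
theorem leftDerived_one_iso_of_projective [PreservesFiniteColimits F] {S : ShortComplex C}
    (hS : S.ShortExact) [Projective S.X₂] :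
    Nonempty ((F.leftDerived 1).obj S.X₃ ≅ kernel (F.map S.f)) := by
  let Q := projectiveResolution S.X₁
  let P := ProjectiveResolution.splice hS Q
  refine ⟨P.isoLeftDerivedObj F 1 ≪≫ ?_⟩
  refine ((F.mapHomologicalComplex _).obj P.complex).homologyIsoSc' 2 1 0 (by simp) (by simp) ≪≫ ?_
  let T := ShortComplex.mk (F.map (Q.complex.d 1 0)) (F.map (Q.augmentation ≫ S.f)) (by
    rw [← F.map_comp, Q.d_augmentation_comp, F.map_zero])
  let hQ : IsColimit (CokernelCofork.ofπ (f := T.f) (F.map Q.augmentation) (by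
      rw [← F.map_comp, Q.d_augmentation, F.map_zero])) :=
    CokernelCofork.mapIsColimit _ Q.isColimitAugmentation F
  have hd : hQ.desc (CokernelCofork.ofπ _ T.zero) = F.map S.f := by
    refine Cofork.IsColimit.hom_ext hQ ?_
    exact (hQ.fac (CokernelCofork.ofπ _ T.zero) WalkingParallelPair.one).trans (F.map_comp _ _)
  let h : T.RightHomologyData :=
    { Q := F.obj S.X₁
      H := kernel (F.map S.f)
      p := F.map Q.augmentation
      ι := kernel.ι _
      wp := _
      hp := hQ
      wι := by rw [hd, kernel.condition]
      hι := KernelFork.IsLimit.ofι' _ _ fun k hk =>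
        ⟨kernel.lift _ k (by rwa [hd] at hk), kernel.lift_ι _ _ _⟩ }
  exact (show T.homology ≅ _ from h.homologyIso)

end DimensionShift

/-! ### Exact sequences of left derived functors with values in modules -/

section ModuleValued

universe v₁ u₁ w

variable {C : Type u₁} [Category.{v₁} C] [Abelian C] {R : Type w} [Ring R]

theorem ModuleCat.comp_apply_eq {X Y Y' Z : ModuleCat.{w} R} {f : X ⟶ Y} {g : Y ⟶ Z} {f' : X ⟶ Y'}
    {g' : Y' ⟶ Z} (h : f ≫ g = f' ≫ g') (x : X) : g.hom (f.hom x) = g'.hom (f'.hom x) :=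
  LinearMap.congr_fun (congrArg ModuleCat.Hom.hom h) x

theorem CategoryTheory.Functor.map_exact_of_shortExact (F : C ⥤ ModuleCat.{w} R)
    [F.Additive] [PreservesFiniteColimits F] {S : ShortComplex C} (hS : S.ShortExact) :
    Function.Exact (F.map S.f).hom (F.map S.g).hom := by
  have := hS.epi_g
  let T := S.map F
  have h : T.Exact := ShortComplex.exact_of_g_is_cokernel T
    (CokernelCofork.mapIsColimit _ hS.gIsCokernel F)
  exact LinearMap.exact_iff.2 h.moduleCat_range_eq_ker.symm

theorem CategoryTheory.Functor.map_surjective_of_shortExact (F : C ⥤ ModuleCat.{w} R)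
    [F.Additive] [PreservesFiniteColimits F] {S : ShortComplex C} (hS : S.ShortExact) :
    Function.Surjective (F.map S.g).hom := by
  have := hS.epi_g
  exact (ModuleCat.epi_iff_surjective _).1 inferInstance

theorem exact_kernel_ι {X Y : ModuleCat.{w} R} (f : X ⟶ Y) :
    Function.Exact (kernel.ι f).hom f.hom :=
  LinearMap.exact_iff.2 (ShortComplex.exact_kernel f).moduleCat_range_eq_ker.symm

/-- The exact sequence `0 → ker f → ker (f ≫ g) → ker g → 0` for an epimorphism `f`. -/
theorem kernel_comp_shortExact {X Y Z : C} (f : X ⟶ Y) [Epi f] (g : Y ⟶ Z) :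
    (ShortComplex.mk (kernel.map f (f ≫ g) (𝟙 _) g (by simp))
      (kernel.map (f ≫ g) g f (𝟙 _) (by simp)) (by
        rw [← cancel_mono (kernel.ι g)]; simp)).ShortExact := by
  have h := kernelCokernelCompSequence_exact f g
  exact
    { exact := h.exact 0
      mono_f := inferInstance
      epi_g := (h.exact 1).epi_f ((isZero_cokernel_of_epi f).eq_of_tgt _ _) }

/-- For a short exact sequence `0 → X₁ → X₂ → X₃ → 0` and an epimorphism `π : P ⟶ X₂`, the kernel
of `P ⟶ X₃` is an extension of `X₁` by the kernel of `π`. -/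
theorem exists_kernel_shortExact {S : ShortComplex C} (hS : S.ShortExact) {P : C} (π : P ⟶ S.X₂)
    [Epi π] : ∃ (a : kernel π ⟶ kernel (π ≫ S.g)) (b : kernel (π ≫ S.g) ⟶ S.X₁) (w : a ≫ b = 0),
      (ShortComplex.mk a b w).ShortExact ∧ a ≫ kernel.ι (π ≫ S.g) = kernel.ι π ∧
        b ≫ S.f = kernel.ι (π ≫ S.g) ≫ π := by
  have := hS.mono_f
  let e : kernel S.g ≅ S.X₁ := (kernelIsKernel S.g).conePointUniqueUpToIso hS.fIsKernel
  have he : e.hom ≫ S.f = kernel.ι S.g :=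
    (kernelIsKernel S.g).conePointUniqueUpToIso_hom_comp hS.fIsKernel WalkingParallelPair.zero
  have h := kernel_comp_shortExact π S.g
  have w : kernel.map π (π ≫ S.g) (𝟙 _) S.g (by simp) ≫
      kernel.map (π ≫ S.g) S.g π (𝟙 _) (by simp) ≫ e.hom = 0 := by
    rw [← cancel_mono S.f]
    simp [he]
  refine ⟨kernel.map π (π ≫ S.g) (𝟙 _) S.g (by simp),
    kernel.map (π ≫ S.g) S.g π (𝟙 _) (by simp) ≫ e.hom, w, ?_, by simp, by simp [he]⟩
  refine ShortComplex.shortExact_of_iso ?_ h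
  exact ShortComplex.isoMk (Iso.refl _) (Iso.refl _) e (by simp) (by simp)

theorem kernel_ι_shortExact {X Y : C} (f : X ⟶ Y) [Epi f] :
    (ShortComplex.mk (kernel.ι f) f (kernel.condition f)).ShortExact :=
  { exact := ShortComplex.exact_kernel f
    mono_f := inferInstance
    epi_g := inferInstance }

variable [HasProjectiveResolutions C] (F : C ⥤ ModuleCat.{w} R) [F.Additive]
  [PreservesFiniteColimits F]

theorem leftDerived_one_exact_of_projective {S : ShortComplex C} (hS : S.ShortExact)
    [Projective S.X₂] : ∃ ι : (F.leftDerived 1).obj S.X₃ ⟶ F.obj S.X₁,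
      Function.Injective ι.hom ∧ Function.Exact ι.hom (F.map S.f).hom := by
  obtain ⟨e⟩ := leftDerived_one_iso_of_projective F hS
  refine ⟨e.hom ≫ kernel.ι _, (ModuleCat.mono_iff_injective _).1 inferInstance, ?_⟩
  have h := exact_kernel_ι (F.map S.f)
  intro x
  rw [h x]
  refine ⟨fun ⟨y, hy⟩ => ⟨e.inv.hom y, ?_⟩, fun ⟨y, hy⟩ => ⟨e.hom.hom y, hy⟩⟩
  rw [← hy]
  have := ModuleCat.comp_apply_eq (f := e.inv) (g := e.hom ≫ kernel.ι (F.map S.f)) (f' := 𝟙 _)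
    (g' := kernel.ι (F.map S.f)) (by simp) y
  exact this

theorem map_injective_of_isZero_leftDerived_one_of_projective {S : ShortComplex C}
    (hS : S.ShortExact) [Projective S.X₂] (h : IsZero ((F.leftDerived 1).obj S.X₃)) :
    Function.Injective (F.map S.f).hom := by
  obtain ⟨ι, -, hι⟩ := leftDerived_one_exact_of_projective F hS
  refine (injective_iff_map_eq_zero _).2 fun x hx => ?_
  obtain ⟨y, rfl⟩ := (hι x).1 hx
  rw [h.eq_of_src ι 0]
  rfl

/-- The vanishing criterion used for every diagram below: one projective presentation whose kernel
stays embedded suffices. -/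
theorem isZero_leftDerived_one_of_injective {S : ShortComplex C}
    (hS : S.ShortExact) [Projective S.X₂] (h : Function.Injective (F.map S.f).hom) :
    IsZero ((F.leftDerived 1).obj S.X₃) := by
  obtain ⟨ι, hi, hι⟩ := leftDerived_one_exact_of_projective F hS
  have : Subsingleton ((F.leftDerived 1).obj S.X₃) := ⟨fun x y => hi <| h <| by
    rw [hι.apply_apply_eq_zero, hι.apply_apply_eq_zero]⟩
  exact ModuleCat.isZero_of_subsingleton _

variable [EnoughProjectives C]

/-- The beginning of the long exact sequence of left derived functors, when the first left derived
functor vanishes at the middle term. -/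
theorem leftDerived_one_exact {S : ShortComplex C} (hS : S.ShortExact)
    (h : IsZero ((F.leftDerived 1).obj S.X₂)) :
    ∃ ι : (F.leftDerived 1).obj S.X₃ ⟶ F.obj S.X₁,
      Function.Injective ι.hom ∧ Function.Exact ι.hom (F.map S.f).hom := by
  have := hS.epi_g
  let π := Projective.π S.X₂
  obtain ⟨a, b, w, hT, ha, hb⟩ := exists_kernel_shortExact hS π
  have hC := kernel_ι_shortExact π
  have hX := kernel_ι_shortExact (π ≫ S.g)
  have : Projective (ShortComplex.mk _ _ (kernel.condition π)).X₂ :=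
    inferInstanceAs (Projective (Projective.over _))
  have : Projective (ShortComplex.mk _ _ (kernel.condition (π ≫ S.g))).X₂ :=
    inferInstanceAs (Projective (Projective.over _))
  obtain ⟨ι, hi, hι⟩ := leftDerived_one_exact_of_projective F hX
  have hinj := map_injective_of_isZero_leftDerived_one_of_projective F hC h
  have hFC := F.map_exact_of_shortExact hC
  have hFT := F.map_exact_of_shortExact hT
  have hFb := F.map_surjective_of_shortExact hT
  have e1 : ∀ x, (F.map (kernel.ι (π ≫ S.g))).hom ((F.map a).hom x) = (F.map (kernel.ι π)).hom x :=
    fun x => ModuleCat.comp_apply_eq (f' := 𝟙 _) (by rw [← F.map_comp, ha, Category.id_comp]) x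
  have e2 : ∀ x, (F.map S.f).hom ((F.map b).hom x) =
      (F.map π).hom ((F.map (kernel.ι (π ≫ S.g))).hom x) :=
    ModuleCat.comp_apply_eq (by rw [← F.map_comp, ← F.map_comp, hb])
  dsimp only at *
  refine ⟨ι ≫ F.map b, ?_, fun y => ⟨fun hy => ?_, ?_⟩⟩
  -- If `ι x` dies in `F S.X₁`, it comes from some `c` in `F (kernel π)`. This `c` dies in the value
  -- at the projective cover, so it is zero by the vanishing at `S.X₂`.
  · refine (injective_iff_map_eq_zero _).2 fun x hx => ?_
    obtain ⟨c, hc⟩ := (hFT _).1 (show (F.map b).hom (ι.hom x) = 0 from hx)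
    have : c = 0 := hinj <| by
      rw [← e1, hc, hι.apply_apply_eq_zero, map_zero]
    rw [this, map_zero] at hc
    exact hi (by rw [← hc, map_zero])
  · obtain ⟨z, rfl⟩ := hFb y
    rw [e2] at hy
    obtain ⟨c, hc⟩ := (hFC _).1 hy
    -- Correcting the lift `z` by `c` puts it in the kernel that realises the derived functor,
    -- without changing its image under `F.map b`.
    obtain ⟨x, hx⟩ := (hι (z - (F.map a).hom c)).1 (by rw [map_sub, e1, hc, sub_self])
    refine ⟨x, ?_⟩
    change (F.map b).hom (ι.hom x) = _
    rw [hx, map_sub, hFT.apply_apply_eq_zero, sub_zero]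
  · rintro ⟨x, rfl⟩
    change (F.map S.f).hom ((F.map b).hom (ι.hom x)) = 0
    rw [e2, hι.apply_apply_eq_zero, map_zero]

/-- The middle term need not be projective here: cover it by `π` and lift an element of the kernel
to `F (kernel (π ≫ S.g))`. Vanishing at `S.X₃` embeds that module in the value at the cover, where
the lift comes from `F (kernel π)`; so it dies in `F S.X₁`. -/
theorem map_injective_of_isZero_leftDerived_one {S : ShortComplex C}
    (hS : S.ShortExact) (h : IsZero ((F.leftDerived 1).obj S.X₃)) :
    Function.Injective (F.map S.f).hom := by
  have := hS.epi_g
  let π := Projective.π S.X₂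
  obtain ⟨a, b, w, hT, ha, hb⟩ := exists_kernel_shortExact hS π
  have hC := kernel_ι_shortExact π
  have hX := kernel_ι_shortExact (π ≫ S.g)
  have : Projective (ShortComplex.mk _ _ (kernel.condition (π ≫ S.g))).X₂ :=
    inferInstanceAs (Projective (Projective.over _))
  have hinj := map_injective_of_isZero_leftDerived_one_of_projective F hX h
  have hFC := F.map_exact_of_shortExact hC
  have hFT := F.map_exact_of_shortExact hT
  have hFb := F.map_surjective_of_shortExact hT
  have e1 : ∀ x, (F.map (kernel.ι (π ≫ S.g))).hom ((F.map a).hom x) = (F.map (kernel.ι π)).hom x :=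
    fun x => ModuleCat.comp_apply_eq (f' := 𝟙 _) (by rw [← F.map_comp, ha, Category.id_comp]) x
  have e2 : ∀ x, (F.map S.f).hom ((F.map b).hom x) =
      (F.map π).hom ((F.map (kernel.ι (π ≫ S.g))).hom x) :=
    ModuleCat.comp_apply_eq (by rw [← F.map_comp, ← F.map_comp, hb])
  dsimp only at *
  refine (injective_iff_map_eq_zero _).2 fun y hy => ?_
  obtain ⟨z, rfl⟩ := hFb y
  rw [e2] at hy
  obtain ⟨c, hc⟩ := (hFC _).1 hy
  rw [← e1] at hc
  rw [← hinj hc, hFT.apply_apply_eq_zero]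

/-- If the first left derived functor vanishes at the first term of a short exact sequence whose
first map stays injective, the first left derived functors of the other terms are isomorphic. -/
theorem leftDerived_one_iso_of_injective {S : ShortComplex C} (hS : S.ShortExact)
    (h₁ : IsZero ((F.leftDerived 1).obj S.X₁)) (hf : Function.Injective (F.map S.f).hom) :
    Nonempty ((F.leftDerived 1).obj S.X₂ ≅ (F.leftDerived 1).obj S.X₃) := by
  have := hS.epi_g
  let π := Projective.π S.X₂
  obtain ⟨a, b, w, hT, ha, hb⟩ := exists_kernel_shortExact hS π
  have hM := kernel_ι_shortExact π
  have hN := kernel_ι_shortExact (π ≫ S.g)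
  have : Projective (ShortComplex.mk _ _ (kernel.condition π)).X₂ :=
    inferInstanceAs (Projective (Projective.over _))
  have : Projective (ShortComplex.mk _ _ (kernel.condition (π ≫ S.g))).X₂ :=
    inferInstanceAs (Projective (Projective.over _))
  obtain ⟨ιM, hiM, hM'⟩ := leftDerived_one_exact_of_projective F hM
  obtain ⟨ιN, hiN, hN'⟩ := leftDerived_one_exact_of_projective F hN
  have hFT := F.map_exact_of_shortExact hT
  have hinj := map_injective_of_isZero_leftDerived_one F hT h₁
  have e1 : ∀ x, (F.map (kernel.ι (π ≫ S.g))).hom ((F.map a).hom x) = (F.map (kernel.ι π)).hom x :=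
    fun x => ModuleCat.comp_apply_eq (f' := 𝟙 _) (by rw [← F.map_comp, ha, Category.id_comp]) x
  have e2 : ∀ x, (F.map S.f).hom ((F.map b).hom x) =
      (F.map π).hom ((F.map (kernel.ι (π ≫ S.g))).hom x) :=
    ModuleCat.comp_apply_eq (by rw [← F.map_comp, ← F.map_comp, hb])
  dsimp only at *
  -- Both derived functors are realised inside `F (kernel (π ≫ S.g))`, and injectivity of `F.map
  -- S.f` makes the two submodules equal.
  have hr : LinearMap.range ((F.map a).hom ∘ₗ ιM.hom) = LinearMap.range ιN.hom := by
    ext x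
    constructor
    · rintro ⟨y, rfl⟩
      exact (hN' _).1 ((e1 _).trans (hM'.apply_apply_eq_zero y))
    · intro hx
      have hx' := (hN' _).2 hx
      have hb0 : (F.map b).hom x = 0 := hf (by rw [e2, hx', map_zero, map_zero])
      obtain ⟨y, rfl⟩ := (hFT _).1 hb0
      rw [e1] at hx'
      obtain ⟨z, rfl⟩ := (hM' _).1 hx'
      exact ⟨z, rfl⟩
  exact ⟨((LinearEquiv.ofInjective ((F.map a).hom ∘ₗ ιM.hom) (hinj.comp hiM)).trans
    ((LinearEquiv.ofEq _ _ hr).trans (LinearEquiv.ofInjective ιN.hom hiN).symm)).toModuleIso⟩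

/-- Dimension shifting along an object at which the first two left derived functors vanish. -/
theorem leftDerived_two_iso {S : ShortComplex C} (hS : S.ShortExact)
    (h₁ : IsZero ((F.leftDerived 1).obj S.X₂)) (h₂ : IsZero ((F.leftDerived 2).obj S.X₂)) :
    Nonempty ((F.leftDerived 2).obj S.X₃ ≅ (F.leftDerived 1).obj S.X₁) := by
  have := hS.epi_g
  let π := Projective.π S.X₂
  obtain ⟨a, b, w, hT, ha, hb⟩ := exists_kernel_shortExact hS π
  have hC := kernel_ι_shortExact π
  have hX := kernel_ι_shortExact (π ≫ S.g)
  have : Projective (ShortComplex.mk _ _ (kernel.condition π)).X₂ :=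
    inferInstanceAs (Projective (Projective.over _))
  have : Projective (ShortComplex.mk _ _ (kernel.condition (π ≫ S.g))).X₂ :=
    inferInstanceAs (Projective (Projective.over _))
  obtain ⟨eC⟩ := leftDerived_two_iso_of_projective F hC
  obtain ⟨eX⟩ := leftDerived_two_iso_of_projective F hX
  have hinj := map_injective_of_isZero_leftDerived_one_of_projective F hC h₁
  have ha' : Function.Injective (F.map a).hom := by
    have : (F.map (kernel.ι (π ≫ S.g))).hom ∘ (F.map a).hom = (F.map (kernel.ι π)).hom :=
      funext fun x => ModuleCat.comp_apply_eq (f' := 𝟙 _)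
        (by rw [← F.map_comp, ha, Category.id_comp]) x
    exact Function.Injective.of_comp (this ▸ hinj)
  -- The second derived functor at `S.X₂` is the first at `kernel π`, which therefore vanishes.
  obtain ⟨e⟩ := leftDerived_one_iso_of_injective F hT (h₂.of_iso eC.symm) ha'
  exact ⟨eX ≪≫ e⟩

end ModuleValued

/-! ### Diagrams of supported submodules of a direct sum -/

section Diagrams

variable {R : Type u} [Ring R] {J : Type u} [SmallCategory J]

theorem shortExact_of_eval {S : ShortComplex (J ⥤ ModuleCat.{u} R)}
    (hf : ∀ i, Function.Injective (S.f.app i).hom)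
    (he : ∀ i y, (S.g.app i).hom y = 0 → ∃ x, (S.f.app i).hom x = y)
    (hg : ∀ i, Function.Surjective (S.g.app i).hom) : S.ShortExact where
  exact := by
    rw [ShortComplex.exact_iff_isZero_homology]
    refine Functor.isZero _ fun i => ?_
    refine IsZero.of_iso ?_ (S.mapHomologyIso ((evaluation J (ModuleCat.{u} R)).obj i)).symm
    rw [← ShortComplex.exact_iff_isZero_homology, ShortComplex.moduleCat_exact_iff]
    exact he i
  mono_f := by
    have : ∀ i, Mono (S.f.app i) := fun i => (ModuleCat.mono_iff_injective _).2 (hf i)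
    exact NatTrans.mono_of_mono_app _
  epi_g := by
    have : ∀ i, Epi (S.g.app i) := fun i => (ModuleCat.epi_iff_surjective _).2 (hg i)
    exact NatTrans.epi_of_epi_app _

theorem CategoryTheory.ShortComplex.ShortExact.eval {S : ShortComplex (J ⥤ ModuleCat.{u} R)}
    (hS : S.ShortExact) (i : J) : Function.Exact (S.f.app i).hom (S.g.app i).hom := by
  have h := (hS.map_of_exact ((evaluation J (ModuleCat.{u} R)).obj i)).exact
  exact LinearMap.exact_iff.2 h.moduleCat_range_eq_ker.symm

theorem app_injective {X Y : J ⥤ ModuleCat.{u} R} (f : X ⟶ Y) [Mono f] (i : J) :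
    Function.Injective (f.app i).hom :=
  (ModuleCat.mono_iff_injective _).1 inferInstance

theorem app_naturality_apply {X Y : J ⥤ ModuleCat.{u} R} (f : X ⟶ Y) {i j : J} (h : i ⟶ j)
    (x : X.obj i) : (f.app j).hom ((X.map h).hom x) = (Y.map h).hom ((f.app i).hom x) :=
  ModuleCat.comp_apply_eq (f.naturality h) x

theorem app_comp_apply {X Y Y' Z : J ⥤ ModuleCat.{u} R} {f : X ⟶ Y} {g : Y ⟶ Z} {f' : X ⟶ Y'}
    {g' : Y' ⟶ Z} (h : f ≫ g = f' ≫ g') (i : J) (x : X.obj i) :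
    (g.app i).hom ((f.app i).hom x) = (g'.app i).hom ((f'.app i).hom x) :=
  ModuleCat.comp_apply_eq (NatTrans.congr_app h i) x

theorem app_comp_apply_eq_zero {X Y Z : J ⥤ ModuleCat.{u} R} {f : X ⟶ Y} {g : Y ⟶ Z}
    (h : f ≫ g = 0) (i : J) (x : X.obj i) : (g.app i).hom ((f.app i).hom x) = 0 :=
  LinearMap.congr_fun (congrArg ModuleCat.Hom.hom (NatTrans.congr_app h i)) x

/-- Every element of a colimit of modules is a finite sum of images of elements of the diagram. -/
theorem colimit_induction {X : J ⥤ ModuleCat.{u} R} {p : ↑(colimit X) → Prop} (h0 : p 0)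
    (hadd : ∀ x y, p x → p y → p (x + y)) (hι : ∀ i x, p ((colimit.ι X i).hom x))
    (x : ↑(colimit X)) : p x := by
  let N : Submodule R ↑(colimit X) := ⨆ i, LinearMap.range (colimit.ι X i).hom
  -- The quotient by the span of the images kills every leg of the colimit cocone, hence is zero.
  have hN : ModuleCat.ofHom N.mkQ = 0 := by
    refine colimit.hom_ext fun i => ModuleCat.hom_ext (LinearMap.ext fun y => ?_)
    exact (Submodule.Quotient.mk_eq_zero N).2
      (le_iSup (fun i => LinearMap.range (colimit.ι X i).hom) i ⟨y, rfl⟩)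
  have hx : x ∈ N := (Submodule.Quotient.mk_eq_zero N).1
    (LinearMap.congr_fun (congrArg ModuleCat.Hom.hom hN) x)
  induction hx using Submodule.iSup_induction' with
  | mem i x hx => obtain ⟨y, rfl⟩ := hx; exact hι i y
  | zero => exact h0
  | add x y _ _ hx hy => exact hadd x y hx hy

theorem colim_map_ι_apply {X Y : J ⥤ ModuleCat.{u} R} (f : X ⟶ Y) (i : J) (x : X.obj i) :
    ((colim : (J ⥤ ModuleCat.{u} R) ⥤ _).map f).hom ((colimit.ι X i).hom x) =
      (colimit.ι Y i).hom ((f.app i).hom x) :=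
  ModuleCat.comp_apply_eq (by simp) x

end Diagrams

/-! ### Families supported in a set of indices -/

section Supported

variable {R : Type u} [Ring R] {T : Type u} (M : T → ModuleCat.{u} R)

/-- The submodule of the families supported in a given set of indices. -/
def supportedIn (s : Set T) : Submodule R (⨁ x, M x) where
  carrier := {f | ∀ x, x ∉ s → f x = 0}
  add_mem' {f g} hf hg x hx := by rw [DirectSum.add_apply, hf x hx, hg x hx, add_zero]
  zero_mem' x _ := rfl
  smul_mem' r f hf x hx := by rw [DirectSum.smul_apply, hf x hx, smul_zero]

variable {M}

theorem supportedIn_mono {s t : Set T} (h : s ⊆ t) : supportedIn M s ≤ supportedIn M t :=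
  fun _ hf x hx => hf x fun hs => hx (h hs)

theorem lof_mem_supportedIn {s : Set T} {x : T} (hx : x ∈ s) (m : M x) :
    DirectSum.lof R T (fun x => M x) x m ∈ supportedIn M s := fun y hy => by
  rw [DirectSum.lof_eq_of, DirectSum.of_eq_of_ne]
  rintro rfl
  exact hy hx

theorem supportedIn_induction {s : Set T} {p : (⨁ x, M x) → Prop} (h0 : p 0)
    (hadd : ∀ f g, p f → p g → p (f + g))
    (hlof : ∀ x ∈ s, ∀ m, p (DirectSum.lof R T (fun x => M x) x m)) {f : ⨁ x, M x}
    (hf : f ∈ supportedIn M s) : p f := by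
  rw [← DirectSum.sum_support_of f]
  refine Finset.sum_induction _ p hadd h0 fun x hx => ?_
  refine hlof x ?_ _
  by_contra h
  exact (DFinsupp.mem_support_iff.1 hx) (hf x h)

theorem supportedIn_hom_ext {s : Set T} {N : Type*} [AddCommGroup N] [Module R N]
    {f g : supportedIn M s →ₗ[R] N}
    (h : ∀ x (hx : x ∈ s) m, f ⟨_, lof_mem_supportedIn hx m⟩ = g ⟨_, lof_mem_supportedIn hx m⟩) :
    f = g := by
  refine LinearMap.ext fun ⟨z, hz⟩ => ?_
  -- The membership proof is part of the induction predicate, since `f` and `g` are defined only on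
  -- the submodule.
  have : ∃ hz : z ∈ supportedIn M s, f ⟨z, hz⟩ = g ⟨z, hz⟩ := by
    refine supportedIn_induction
      (p := fun z => ∃ hz : z ∈ supportedIn M s, f ⟨z, hz⟩ = g ⟨z, hz⟩) ?_ ?_ ?_ hz
    · exact ⟨zero_mem _, (map_zero _).trans (map_zero _).symm⟩
    · rintro a b ⟨ha, ha'⟩ ⟨hb, hb'⟩
      exact ⟨add_mem ha hb, (map_add f ⟨a, ha⟩ ⟨b, hb⟩).trans <|
        (congrArg₂ (· + ·) ha' hb').trans (map_add g ⟨a, ha⟩ ⟨b, hb⟩).symm⟩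
    · intro x hx m
      exact ⟨_, h x hx m⟩
  exact this.choose_spec

end Supported

/-! ### Colimits of diagrams of supported families -/

section SupportDiagram

variable {R : Type u} [Ring R] {T : Type u} (M : T → ModuleCat.{u} R)
  {I : Type u} [PartialOrder I] {Y : I → Set T} (hY : Monotone Y)

/-- The diagram of the families supported in `Y i`, for a monotone family of sets `Y`. -/
def supportDiagram : I ⥤ ModuleCat.{u} R where
  obj i := ModuleCat.of R (supportedIn M (Y i))
  map h := ModuleCat.ofHom (Submodule.inclusion (supportedIn_mono (hY h.le)))

/-- The inclusion of the families supported in `Y i` into the whole direct sum. -/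
def supportCocone : Cocone (supportDiagram M hY) where
  pt := ModuleCat.of R (⨁ x, M x)
  ι := { app := fun i => ModuleCat.ofHom (supportedIn M (Y i)).subtype }

/-- The canonical map from the colimit of a diagram of supported families to the direct sum. -/
def supportColimitMap : colimit (supportDiagram M hY) ⟶ ModuleCat.of R (⨁ x, M x) :=
  colimit.desc _ (supportCocone M hY)

theorem supportColimitMap_ι (i : I) (f : (supportDiagram M hY).obj i) :
    (supportColimitMap M hY).hom ((colimit.ι (supportDiagram M hY) i).hom f) =
      (f : supportedIn M (Y i)).1 :=
  LinearMap.congr_fun (congrArg ModuleCat.Hom.hom (colimit.ι_desc (supportCocone M hY) i)) f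

/-- The indices of the sets containing a given point form a codirected family. -/
def IsLocallyCodirected (Y : I → Set T) : Prop :=
  ∀ i j, ∀ x, x ∈ Y i → x ∈ Y j → ∃ k, k ≤ i ∧ k ≤ j ∧ x ∈ Y k

/-- The image in the colimit of a family concentrated at one point of `Y i`. -/
def supportColimitLof (x : T) (i : I) (hi : x ∈ Y i) :
    M x →ₗ[R] ↑(colimit (supportDiagram M hY)) :=
  (colimit.ι (supportDiagram M hY) i).hom ∘ₗ
    (DirectSum.lof R T (fun x => M x) x).codRestrict (supportedIn M (Y i))
      (lof_mem_supportedIn hi)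

theorem supportColimitLof_of_le (x : T) {i j : I} (h : i ≤ j) (hi : x ∈ Y i) :
    supportColimitLof M hY x j (hY h hi) = supportColimitLof M hY x i hi := by
  refine LinearMap.ext fun m => ?_
  exact LinearMap.congr_fun (congrArg ModuleCat.Hom.hom
    (colimit.w (supportDiagram M hY) (homOfLE h))) ⟨_, lof_mem_supportedIn hi m⟩

/-- There is a left inverse: send a family concentrated at `x` to its class at any index whose set
contains `x`. Two such indices have a common lower bound still containing `x`, so the class does not
depend on the choice. -/
theorem supportColimitMap_injective (hc : IsLocallyCodirected Y) :
    Function.Injective (supportColimitMap M hY).hom := by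
  -- Points lying in no `Y i` go to zero; they never occur in families coming from the colimit.
  let ψ : (⨁ x, M x) →ₗ[R] ↑(colimit (supportDiagram M hY)) :=
    DirectSum.toModule R T _ fun x =>
      if h : ∃ i, x ∈ Y i then supportColimitLof M hY x h.choose h.choose_spec else 0
  have hψ : ∀ i x (hi : x ∈ Y i) (m : M x),
      ψ (DirectSum.lof R T (fun x => M x) x m) = supportColimitLof M hY x i hi m := by
    intro i x hi m
    have h : ∃ i, x ∈ Y i := ⟨i, hi⟩
    obtain ⟨k, hk, hk', hx⟩ := hc i h.choose x hi h.choose_spec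
    refine (DirectSum.toModule_lof (M := fun x => M x) R x m).trans ?_
    rw [dif_pos h, supportColimitLof_of_le M hY x hk hx, supportColimitLof_of_le M hY x hk' hx]
  refine Function.LeftInverse.injective (g := ψ) fun c => ?_
  refine colimit_induction (p := fun c => ψ ((supportColimitMap M hY).hom c) = c) ?_ ?_ ?_ c
  · simp
  · intro a b ha hb
    rw [map_add, map_add, ha, hb]
  · rintro i ⟨f, hf⟩
    refine (congrArg ψ (supportColimitMap_ι M hY i ⟨f, hf⟩)).trans ?_
    have h : ψ ∘ₗ (supportedIn M (Y i)).subtype = (colimit.ι (supportDiagram M hY) i).hom :=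
      supportedIn_hom_ext fun x hx m => hψ i x hx m
    exact LinearMap.congr_fun h ⟨f, hf⟩

theorem mem_range_supportColimitMap {f : ⨁ x, M x} (hf : f ∈ supportedIn M (⋃ i, Y i)) :
    ∃ c, (supportColimitMap M hY).hom c = f := by
  refine supportedIn_induction (p := fun f => ∃ c, (supportColimitMap M hY).hom c = f)
    ⟨0, map_zero _⟩ ?_ ?_ hf
  · rintro _ _ ⟨a, rfl⟩ ⟨b, rfl⟩
    exact ⟨a + b, map_add _ _ _⟩
  · intro x hx m
    obtain ⟨i, hi⟩ := Set.mem_iUnion.1 hx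
    exact ⟨supportColimitLof M hY x i hi m, supportColimitMap_ι M hY i _⟩

end SupportDiagram

/-! ### Principal diagrams and projectivity -/

section SupportMap

variable {R : Type u} [Ring R] {T : Type u} {M N : T → ModuleCat.{u} R}
  {I : Type u} [PartialOrder I] {Y : I → Set T} (hY : Monotone Y)

theorem lmap_mem_supportedIn (φ : ∀ x, M x →ₗ[R] N x) {s : Set T} (f : ⨁ x, M x)
    (hf : f ∈ supportedIn M s) : DirectSum.lmap φ f ∈ supportedIn N s := fun x hx => by
  rw [DirectSum.lmap_apply, hf x hx, map_zero]

/-- The map of diagrams of supported families induced by homomorphisms of modules. -/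
def supportMap (φ : ∀ x, M x →ₗ[R] N x) : supportDiagram M hY ⟶ supportDiagram N hY where
  app i := ModuleCat.ofHom ((DirectSum.lmap φ).restrict (lmap_mem_supportedIn φ))

/-- Preimages are chosen only on the finite support of `g` and are zero elsewhere, which keeps the
lift finitely supported and inside `s`. -/
theorem exists_lmap_eq (φ : ∀ x, M x →ₗ[R] N x) {s : Set T} (g : ⨁ x, N x)
    (hg : g ∈ supportedIn N s) (h : ∀ x, ∃ m, φ x m = g x) :
    ∃ f ∈ supportedIn M s, DirectSum.lmap φ f = g := by
  choose c hc using h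
  let c' : ∀ x : T, M x := fun x => if g x = 0 then 0 else c x
  have hc' : ∀ x, φ x (c' x) = g x := by
    intro x
    by_cases h : g x = 0
    · simp [c', h]
    · simp [c', h, hc]
  let f : ⨁ x, M x := DFinsupp.mk (β := fun x => M x) g.support fun x => c' x
  have hf : ∀ x, f x = if g x = 0 then 0 else c' x := fun x => by
    refine (DFinsupp.mk_apply (β := fun x => M x)).trans ?_
    by_cases h : g x = 0
    · rw [if_pos h, dif_neg (DFinsupp.notMem_support_iff.2 h)]
    · rw [if_neg h, dif_pos (DFinsupp.mem_support_iff.2 h)]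
  refine ⟨f, fun x hx => by rw [hf, if_pos (hg x hx)], DFinsupp.ext fun x => ?_⟩
  rw [DirectSum.lmap_apply, hf]
  by_cases h : g x = 0
  · rw [if_pos h, h, map_zero]
  · rw [if_neg h, hc']

theorem supportMap_shortExact {K : T → ModuleCat.{u} R} (φ : ∀ x, K x →ₗ[R] N x)
    (ψ : ∀ x, N x →ₗ[R] M x) (hφ : ∀ x, Function.Injective (φ x))
    (h : ∀ x, Function.Exact (φ x) (ψ x)) (hψ : ∀ x, Function.Surjective (ψ x)) :
    ∃ w, (ShortComplex.mk (supportMap hY φ) (supportMap hY ψ) w).ShortExact := by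
  refine ⟨?_, shortExact_of_eval ?_ ?_ ?_⟩
  · refine NatTrans.ext (funext fun i => ModuleCat.hom_ext (LinearMap.ext fun f =>
      Subtype.ext (DFinsupp.ext fun x => ?_)))
    refine (DirectSum.lmap_apply ψ _ x).trans ?_
    refine (congrArg (ψ x) (DirectSum.lmap_apply φ _ x)).trans ?_
    exact (h x).apply_apply_eq_zero _
  · intro i f g hfg
    refine Subtype.ext (DFinsupp.ext fun x => hφ x ?_)
    have := DFunLike.congr_fun (congrArg Subtype.val hfg) x
    exact (DirectSum.lmap_apply φ _ x).symm.trans (this.trans (DirectSum.lmap_apply φ _ x))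
  · rintro i ⟨g, hg⟩ hg0
    obtain ⟨f, hf, hfg⟩ := exists_lmap_eq φ g hg fun x => (h x _).1 <|
      (DirectSum.lmap_apply ψ _ x).symm.trans (DFunLike.congr_fun (congrArg Subtype.val hg0) x)
    exact ⟨⟨f, hf⟩, Subtype.ext hfg⟩
  · rintro i ⟨g, hg⟩
    obtain ⟨f, hf, hfg⟩ := exists_lmap_eq ψ g hg fun x => hψ x _
    exact ⟨⟨f, hf⟩, Subtype.ext hfg⟩

/-- The colimit of the source embeds in its direct sum, on which the map is coordinatewise `φ`. -/
theorem colimMap_supportMap_injective (hc : IsLocallyCodirected Y) (φ : ∀ x, M x →ₗ[R] N x)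
    (hφ : ∀ x, Function.Injective (φ x)) :
    Function.Injective ((colim : (I ⥤ ModuleCat.{u} R) ⥤ _).map (supportMap hY φ)).hom := by
  have h : ∀ c, (supportColimitMap N hY).hom
      (((colim : (I ⥤ ModuleCat.{u} R) ⥤ _).map (supportMap hY φ)).hom c) =
        DirectSum.lmap φ ((supportColimitMap M hY).hom c) := by
    intro c
    refine colimit_induction (p := fun c => (supportColimitMap N hY).hom
      (((colim : (I ⥤ ModuleCat.{u} R) ⥤ _).map (supportMap hY φ)).hom c) =
        DirectSum.lmap φ ((supportColimitMap M hY).hom c)) ?_ ?_ ?_ c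
    · simp only [map_zero]
    · intro a b ha hb
      simp only [map_add, ha, hb]
    · intro i f
      rw [colim_map_ι_apply, supportColimitMap_ι, supportColimitMap_ι]
      rfl
  have hl : Function.Injective (DirectSum.lmap φ) := fun f g hfg => DFinsupp.ext fun x => hφ x <| by
    rw [← DirectSum.lmap_apply, ← DirectSum.lmap_apply, hfg]
  refine Function.Injective.of_comp (f := (supportColimitMap N hY).hom) ?_
  rw [show (supportColimitMap N hY).hom ∘ _ = _ from funext h]
  exact hl.comp (supportColimitMap_injective M hY hc)

end SupportMap

/-! ### Diagrams freely generated at birth indices -/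

section Principal

variable {R : Type u} [Ring R] {T : Type u} (M : T → ModuleCat.{u} R)
  {I : Type u} [PartialOrder I] (S : Set T) (b : T → I)

/-- The points of `S` whose birth index is at most `i`. -/
def principalSets (i : I) : Set T := {x | x ∈ S ∧ b x ≤ i}

theorem principalSets_monotone : Monotone (principalSets S b) :=
  fun _ _ h _ hx => ⟨hx.1, hx.2.trans h⟩

theorem principalSets_isLocallyCodirected : IsLocallyCodirected (principalSets S b) :=
  fun _ _ x hi hj => ⟨b x, hi.2, hj.2, hi.1, le_rfl⟩

/-- The diagram freely generated by modules `M x` placed at the indices `b x`, for `x ∈ S`. -/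
abbrev principalDiagram : I ⥤ ModuleCat.{u} R := supportDiagram M (principalSets_monotone S b)

variable {M S b} {D : I ⥤ ModuleCat.{u} R} (φ : ∀ x, M x →ₗ[R] D.obj (b x))

/-- The component at `i` of the map out of a principal diagram, on all families. -/
def principalDescAux (i : I) : (⨁ x, M x) →ₗ[R] D.obj i :=
  DirectSum.toModule R T _ fun x => if h : b x ≤ i then (D.map (homOfLE h)).hom ∘ₗ φ x else 0

theorem principalDescAux_lof (i : I) (x : T) (h : b x ≤ i) (m : M x) :
    principalDescAux φ i (DirectSum.lof R T (fun x => M x) x m) =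
      (D.map (homOfLE h)).hom (φ x m) := by
  refine (DirectSum.toModule_lof (M := fun x => M x) R x m).trans ?_
  rw [dif_pos h]
  rfl

variable (S) in
/-- The map out of a principal diagram determined by its values on the generating modules. -/
def principalDesc : principalDiagram M S b ⟶ D where
  app i := ModuleCat.ofHom (principalDescAux φ i ∘ₗ (supportedIn M _).subtype)
  naturality {i j} h := by
    refine ModuleCat.hom_ext (LinearMap.ext fun f => ?_)
    refine supportedIn_induction (p := fun f => principalDescAux φ j f =
      (D.map h).hom (principalDescAux φ i f)) ?_ ?_ ?_ f.2
    · rw [map_zero, map_zero, map_zero]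
    · intro f g hf hg
      rw [map_add, map_add, map_add, hf, hg]
    · intro x hx m
      rw [principalDescAux_lof φ i x hx.2, principalDescAux_lof φ j x (hx.2.trans h.le)]
      exact LinearMap.congr_fun (congrArg ModuleCat.Hom.hom (D.map_comp (homOfLE hx.2) h)) _

theorem principalDesc_lof (i : I) (x : T) (hx : x ∈ principalSets S b i) (m : M x) :
    ((principalDesc S φ).app i).hom ⟨_, lof_mem_supportedIn hx m⟩ =
      (D.map (homOfLE hx.2)).hom (φ x m) :=
  principalDescAux_lof φ i x hx.2 m

theorem support_hom_ext {Y : I → Set T} {hY : Monotone Y} {f g : supportDiagram M hY ⟶ D}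
    (h : ∀ i x (hx : x ∈ Y i) m, (f.app i).hom ⟨_, lof_mem_supportedIn hx m⟩ =
      (g.app i).hom ⟨_, lof_mem_supportedIn hx m⟩) : f = g := by
  exact NatTrans.ext (funext fun i => ModuleCat.hom_ext (supportedIn_hom_ext (h i)))

theorem principal_hom_ext {f g : principalDiagram M S b ⟶ D}
    (h : ∀ x (hx : x ∈ S) m,
      (f.app (b x)).hom ⟨_, lof_mem_supportedIn (s := principalSets S b (b x)) ⟨hx, le_rfl⟩ m⟩ =
      (g.app (b x)).hom ⟨_, lof_mem_supportedIn (s := principalSets S b (b x)) ⟨hx, le_rfl⟩ m⟩) :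
    f = g := by
  refine support_hom_ext fun i x hx m => ?_
  have e := app_naturality_apply f (homOfLE hx.2)
    ⟨_, lof_mem_supportedIn (s := principalSets S b (b x)) ⟨hx.1, le_rfl⟩ m⟩
  have e' := app_naturality_apply g (homOfLE hx.2)
    ⟨_, lof_mem_supportedIn (s := principalSets S b (b x)) ⟨hx.1, le_rfl⟩ m⟩
  exact e.trans ((congrArg _ (h x hx.1 m)).trans e'.symm)

/-- A map out of the diagram amounts to an arbitrary homomorphism from `M x` to the value at `b x`
for each `x ∈ S`. Lifting along an epimorphism is thus a separate problem for each `M x`, at the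
index `b x`. -/
theorem principalDiagram_projective (hM : ∀ x, Projective (M x)) :
    Projective (principalDiagram M S b) where
  factors {E X} f e _ := by
    have hl : ∀ x, ∃ l : M x ⟶ E.obj (b x), ∀ hx : x ∈ S, ∀ m, (e.app (b x)).hom (l.hom m) =
        (f.app (b x)).hom
          ⟨_, lof_mem_supportedIn (s := principalSets S b (b x)) ⟨hx, le_rfl⟩ m⟩ := by
      intro x
      by_cases hx : x ∈ S
      · let g : M x ⟶ X.obj (b x) := ModuleCat.ofHom ((f.app (b x)).hom ∘ₗ
          (DirectSum.lof R T (fun x => M x) x).codRestrict (supportedIn M (principalSets S b (b x)))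
            (lof_mem_supportedIn (s := principalSets S b (b x)) ⟨hx, le_rfl⟩))
        exact ⟨Projective.factorThru g (e.app (b x)), fun _ m => LinearMap.congr_fun
          (congrArg ModuleCat.Hom.hom (Projective.factorThru_comp g (e.app (b x)))) m⟩
      · exact ⟨0, fun h => absurd h hx⟩
    choose l hl using hl
    refine ⟨principalDesc S fun x => (l x).hom, principal_hom_ext fun x hx m => ?_⟩
    have h1 := principalDesc_lof (S := S) (fun x => (l x).hom) (b x) x ⟨hx, le_rfl⟩ m
    refine (congrArg (e.app (b x)).hom h1).trans ?_
    have h3 : (E.map (homOfLE (le_refl (b x)))).hom ((l x).hom m) = (l x).hom m :=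
      LinearMap.congr_fun (congrArg ModuleCat.Hom.hom (E.map_id (b x))) _
    rw [h3]
    exact hl x hx m

end Principal

/-! ### Acyclicity of diagrams of supported families -/

section Acyclic

variable {R : Type u} [Ring R] {T : Type u} (M : T → ModuleCat.{u} R)
  {I : Type u} [PartialOrder I]

/-- Covering each `M x` by a projective gives a short exact sequence of principal diagrams on the
same `S` and `b`, with projective middle term and a kernel that stays embedded in the colimit. -/
theorem principalDiagram_isZero_one (S : Set T) (b : T → I) :
    IsZero ((derivedColim I R 1).obj (principalDiagram M S b)) := by
  obtain ⟨w, h⟩ := supportMap_shortExact (principalSets_monotone S b)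
    (K := fun x => kernel (Projective.π (M x))) (N := fun x => Projective.over (M x)) (M := M)
    (fun x => (kernel.ι (Projective.π (M x))).hom) (fun x => (Projective.π (M x)).hom)
    (fun x => (ModuleCat.mono_iff_injective _).1 inferInstance)
    (fun x => exact_kernel_ι _)
    (fun x => (ModuleCat.epi_iff_surjective _).1 inferInstance)
  have : Projective (ShortComplex.mk _ _ w).X₂ :=
    principalDiagram_projective fun x => Projective.projective_over _
  exact isZero_leftDerived_one_of_injective colim h <|
    colimMap_supportMap_injective _ (principalSets_isLocallyCodirected S b) _
      fun x => (ModuleCat.mono_iff_injective _).1 inferInstance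

/-- The kernel in that sequence is again principal, so dimension shifting reduces to the previous
case. -/
theorem principalDiagram_isZero_two (S : Set T) (b : T → I) :
    IsZero ((derivedColim I R 2).obj (principalDiagram M S b)) := by
  obtain ⟨w, h⟩ := supportMap_shortExact (principalSets_monotone S b)
    (K := fun x => kernel (Projective.π (M x))) (N := fun x => Projective.over (M x)) (M := M)
    (fun x => (kernel.ι (Projective.π (M x))).hom) (fun x => (Projective.π (M x)).hom)
    (fun x => (ModuleCat.mono_iff_injective _).1 inferInstance)
    (fun x => exact_kernel_ι _)
    (fun x => (ModuleCat.epi_iff_surjective _).1 inferInstance)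
  have : Projective (ShortComplex.mk _ _ w).X₂ :=
    principalDiagram_projective fun x => Projective.projective_over _
  obtain ⟨e⟩ := leftDerived_two_iso_of_projective (F := colim) h
  exact (principalDiagram_isZero_one _ S b).of_iso e

variable {M}

/-- The inclusion of diagrams of supported families induced by inclusions of supports. -/
def supportIncl {Y Y' : I → Set T} (hY : Monotone Y) (hY' : Monotone Y') (h : ∀ i, Y i ⊆ Y' i) :
    supportDiagram M hY ⟶ supportDiagram M hY' where
  app i := ModuleCat.ofHom (Submodule.inclusion (supportedIn_mono (h i)))

theorem supportIncl_mono {Y Y' : I → Set T} (hY : Monotone Y) (hY' : Monotone Y')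
    (h : ∀ i, Y i ⊆ Y' i) : Mono (supportIncl (M := M) hY hY' h) := by
  have : ∀ i, Mono ((supportIncl (M := M) hY hY' h).app i) := fun i =>
    (ModuleCat.mono_iff_injective _).2 (Submodule.inclusion_injective (supportedIn_mono (h i)))
  exact NatTrans.mono_of_mono_app _

/-- Both colimits map compatibly to one direct sum; only the smaller one has to embed in it. -/
theorem colimMap_supportIncl_injective {Y Y' : I → Set T} (hY : Monotone Y) (hY' : Monotone Y')
    (h : ∀ i, Y i ⊆ Y' i) (hc : IsLocallyCodirected Y) : Function.Injective
      ((colim : (I ⥤ ModuleCat.{u} R) ⥤ _).map (supportIncl (M := M) hY hY' h)).hom := by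
  have h : ∀ c, (supportColimitMap M hY').hom
      (((colim : (I ⥤ ModuleCat.{u} R) ⥤ _).map (supportIncl hY hY' h)).hom c) =
        (supportColimitMap M hY).hom c := by
    intro c
    refine colimit_induction (p := fun c => (supportColimitMap M hY').hom
      (((colim : (I ⥤ ModuleCat.{u} R) ⥤ _).map (supportIncl hY hY' h)).hom c) =
        (supportColimitMap M hY).hom c) ?_ ?_ ?_ c
    · simp only [map_zero]
    · intro a b ha hb
      simp only [map_add, ha, hb]
    · intro i f
      rw [colim_map_ι_apply, supportColimitMap_ι, supportColimitMap_ι]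
      rfl
  refine Function.Injective.of_comp (f := (supportColimitMap M hY').hom) ?_
  rw [show (supportColimitMap M hY').hom ∘ _ = _ from funext h]
  exact supportColimitMap_injective M hY hc

end Acyclic

/-! ### Free covers of a diagram and of its subdiagrams -/

section FreeCover

variable {R : Type u} [Ring R] {I : Type u} [PartialOrder I] (D : I ⥤ ModuleCat.{u} R)

/-- The free diagram on all elements of `D` in a given set. -/
abbrev freeDiagram (S : Set (Σ i, D.obj i)) : I ⥤ ModuleCat.{u} R :=
  principalDiagram (fun _ => ModuleCat.of R R) S Sigma.fst

theorem freeDiagram_projective (S : Set (Σ i, D.obj i)) : Projective (freeDiagram D S) :=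
  principalDiagram_projective fun _ =>
    ModuleCat.projective_of_free (Module.Basis.singleton Unit R)

variable {D}

/-- A multiple of a generator of a free diagram. -/
def freeElement {S : Set (Σ i, D.obj i)} (p : Σ i, D.obj i) (hp : p ∈ S) (r : R) :
    (freeDiagram D S).obj p.1 :=
  (⟨_, lof_mem_supportedIn (M := fun _ : (Σ i, D.obj i) => ModuleCat.of R R)
    (s := principalSets S Sigma.fst p.1) (x := p) ⟨hp, le_rfl⟩ r⟩ :
      supportedIn (fun _ : (Σ i, D.obj i) => ModuleCat.of R R) (principalSets S Sigma.fst p.1))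

variable {X : I ⥤ ModuleCat.{u} R}

/-- The map out of a free diagram determined by the images of the generators. -/
def freeDesc (S : Set (Σ i, D.obj i)) (c : ∀ p : (Σ i, D.obj i), X.obj p.1) :
    freeDiagram D S ⟶ X :=
  principalDesc S fun p : (Σ i, D.obj i) => LinearMap.toSpanSingleton R (X.obj p.1) (c p)

theorem freeDesc_freeElement (S : Set (Σ i, D.obj i)) (c : ∀ p : (Σ i, D.obj i), X.obj p.1)
    (p : Σ i, D.obj i) (hp : p ∈ S) (r : R) :
    ((freeDesc S c).app p.1).hom (freeElement p hp r) = r • c p := by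
  refine (principalDesc_lof (M := fun _ : (Σ i, D.obj i) => ModuleCat.of R R) (S := S)
    (fun p : (Σ i, D.obj i) => LinearMap.toSpanSingleton R (X.obj p.1) (c p)) p.1 p
    ⟨hp, le_rfl⟩ r).trans ?_
  exact LinearMap.congr_fun (congrArg ModuleCat.Hom.hom (X.map_id p.1)) _

theorem free_hom_ext {S : Set (Σ i, D.obj i)} {f g : freeDiagram D S ⟶ X}
    (h : ∀ p (hp : p ∈ S) (r : R), (f.app p.1).hom (freeElement p hp r) =
      (g.app p.1).hom (freeElement p hp r)) : f = g :=
  principal_hom_ext h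

variable (D) in
/-- The canonical map onto `D` from the free diagram on all elements of `D`. -/
def freeCover : freeDiagram D Set.univ ⟶ D := freeDesc Set.univ fun p => p.2

instance freeCover_epi : Epi (freeCover D) := by
  have : ∀ i, Epi ((freeCover D).app i) := fun i => (ModuleCat.epi_iff_surjective _).2 fun d =>
    ⟨freeElement ⟨i, d⟩ trivial 1, (freeDesc_freeElement Set.univ (fun p => p.2) ⟨i, d⟩
      trivial 1).trans (one_smul R d)⟩
  exact NatTrans.epi_of_epi_app _

variable {D' : I ⥤ ModuleCat.{u} R} (m : D' ⟶ D)

/-- The elements of `D` in the image of `m`. -/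
def imageElements : Set (Σ i, D.obj i) := {p | ∃ d, (m.app p.1).hom d = p.2}

/-- A preimage of an element of `D`, or zero. -/
def imageLift (p : Σ i, D.obj i) : D'.obj p.1 :=
  if h : ∃ d, (m.app p.1).hom d = p.2 then h.choose else 0

theorem app_imageLift (p : Σ i, D.obj i) (hp : p ∈ imageElements m) :
    (m.app p.1).hom (imageLift m p) = p.2 := by
  have h : ∃ d, (m.app p.1).hom d = p.2 := hp
  rw [imageLift, dif_pos h, h.choose_spec]

/-- The map to `D'` from the free diagram on the elements of `D` in the image of `m : D' ⟶ D`. -/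
def imageFreeCover : freeDiagram D (imageElements m) ⟶ D' :=
  freeDesc (imageElements m) (imageLift m)

/-- The inclusion of the free diagram on the image of `m` into the free diagram on `D`. -/
def imageFreeIncl : freeDiagram D (imageElements m) ⟶ freeDiagram D Set.univ :=
  supportIncl _ _ fun _ _ hp => ⟨trivial, hp.2⟩

theorem imageFreeCover_comp : imageFreeCover m ≫ m = imageFreeIncl m ≫ freeCover D := by
  refine free_hom_ext fun p hp r => ?_
  refine (congrArg (m.app p.1).hom
    (freeDesc_freeElement (imageElements m) (imageLift m) p hp r)).trans ?_
  refine ((m.app p.1).hom.map_smul r _).trans ?_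
  rw [app_imageLift m p hp]
  exact (freeDesc_freeElement Set.univ (fun p => p.2) p trivial r).symm

theorem imageFreeCover_epi [Mono m] : Epi (imageFreeCover m) := by
  have : ∀ i, Epi ((imageFreeCover m).app i) := fun i =>
    (ModuleCat.epi_iff_surjective _).2 fun d => by
      have hp : (⟨i, (m.app i).hom d⟩ : Σ i, D.obj i) ∈ imageElements m := ⟨d, rfl⟩
      refine ⟨freeElement _ hp 1, app_injective m i ?_⟩
      refine (congrArg (m.app i).hom
        (freeDesc_freeElement (imageElements m) (imageLift m) _ hp 1)).trans ?_
      rw [one_smul]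
      exact app_imageLift m _ hp
  exact NatTrans.epi_of_epi_app _

/-- The map between kernels of free covers induced by `m : D' ⟶ D`. -/
def imageKernelMap : kernel (imageFreeCover m) ⟶ kernel (freeCover D) :=
  kernel.map _ _ (imageFreeIncl m) m (imageFreeCover_comp m)

theorem imageKernelMap_ι :
    imageKernelMap m ≫ kernel.ι (freeCover D) = kernel.ι (imageFreeCover m) ≫ imageFreeIncl m :=
  kernel.lift_ι _ _ _

instance imageFreeIncl_mono : Mono (imageFreeIncl m) := supportIncl_mono _ _ _

instance imageKernelMap_mono : Mono (imageKernelMap m) := by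
  have : Mono (imageKernelMap m ≫ kernel.ι (freeCover D)) := by
    rw [imageKernelMap_ι]
    infer_instance
  exact mono_of_mono (imageKernelMap m) (kernel.ι (freeCover D))

/-- The family underlying an element of the kernel of the free cover. -/
def kernelFamily (i : I) (k : (kernel (freeCover D)).obj i) :
    ⨁ _ : (Σ i, D.obj i), ModuleCat.of R R :=
  (show supportedIn (fun _ : (Σ i, D.obj i) => ModuleCat.of R R)
    (principalSets Set.univ Sigma.fst i) from ((kernel.ι (freeCover D)).app i).hom k).1

/-- A relation among elements of `D` that all come from `D'` already holds in `D'`, because `m` is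
injective. -/
theorem mem_range_imageKernelMap [Mono m] (i : I) (k : (kernel (freeCover D)).obj i)
    (hk : ∀ p ∈ (kernelFamily i k).support, p ∈ imageElements m) :
    ∃ k', ((imageKernelMap m).app i).hom k' = k := by
  have := imageFreeCover_epi m
  let z : (freeDiagram D Set.univ).obj i := ((kernel.ι (freeCover D)).app i).hom k
  have hz : ((freeCover D).app i).hom z = 0 :=
    app_comp_apply_eq_zero (kernel.condition (freeCover D)) i k
  let z' : (freeDiagram D (imageElements m)).obj i :=
    (⟨kernelFamily i k, fun p hp => by
      by_contra h
      refine hp ⟨hk p (DFinsupp.mem_support_iff.2 h), ?_⟩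
      by_contra h'
      exact h ((show supportedIn (fun _ : (Σ i, D.obj i) => ModuleCat.of R R)
        (principalSets Set.univ Sigma.fst i) from z).2 p fun h'' => h' h''.2)⟩ :
      supportedIn (fun _ : (Σ i, D.obj i) => ModuleCat.of R R)
        (principalSets (imageElements m) Sigma.fst i))
  have hzz : ((imageFreeIncl m).app i).hom z' = z := rfl
  have hz' : ((imageFreeCover m).app i).hom z' = 0 := by
    refine app_injective m i ?_
    refine (app_comp_apply (imageFreeCover_comp m) i z').trans ?_
    rw [map_zero]
    exact hz
  obtain ⟨k', hk'⟩ := ((kernel_ι_shortExact (imageFreeCover m)).eval i z').1 hz'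
  refine ⟨k', app_injective (kernel.ι (freeCover D)) i ?_⟩
  refine (app_comp_apply (imageKernelMap_ι m) i k').trans ?_
  exact congrArg ((imageFreeIncl m).app i).hom hk'

end FreeCover

/-! ### Vanishing of derived colimits by finite approximation -/

section Approximation

variable {R : Type u} [Ring R] {I : Type u} [PartialOrder I]

/-- Any finite set of elements of `D` lies in a subdiagram with the property `P`. -/
def FinitelyApproximated (P : (I ⥤ ModuleCat.{u} R) → Prop) (D : I ⥤ ModuleCat.{u} R) : Prop :=
  ∀ s : Finset (Σ i, D.obj i), ∃ (D' : I ⥤ ModuleCat.{u} R) (m : D' ⟶ D), Mono m ∧ P D' ∧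
    ∀ p ∈ s, p ∈ imageElements m

/-- A class in the colimit of the kernel of the free cover involves finitely many elements of `D`,
so it comes from an acyclic subdiagram containing them. The approximating subdiagrams need not form
a directed system. -/
theorem FinitelyApproximated.isZero_one {D : I ⥤ ModuleCat.{u} R}
    (h : FinitelyApproximated (fun D' => IsZero ((derivedColim I R 1).obj D')) D) :
    IsZero ((derivedColim I R 1).obj D) := by
  have hD := kernel_ι_shortExact (freeCover D)
  have : Projective (ShortComplex.mk _ _ (kernel.condition (freeCover D))).X₂ :=
    freeDiagram_projective D _
  refine isZero_leftDerived_one_of_injective colim hD ?_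
  refine (injective_iff_map_eq_zero _).2 fun k hk => ?_
  -- The finite set is fixed before `D'`, which is then obtained from the approximation hypothesis.
  have hs : ∃ s : Finset (Σ i, D.obj i), ∀ (D' : I ⥤ ModuleCat.{u} R) (m : D' ⟶ D), Mono m →
      (∀ p ∈ s, p ∈ imageElements m) → ∃ k', (colim.map (imageKernelMap m)).hom k' = k := by
    refine colimit_induction (p := fun k => ∃ s : Finset (Σ i, D.obj i),
      ∀ (D' : I ⥤ ModuleCat.{u} R) (m : D' ⟶ D), Mono m →
      (∀ p ∈ s, p ∈ imageElements m) → ∃ k', (colim.map (imageKernelMap m)).hom k' = k) ?_ ?_ ?_ k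
    · exact ⟨∅, fun D' m _ _ => ⟨0, map_zero _⟩⟩
    · rintro x y ⟨s, hs⟩ ⟨t, ht⟩
      refine ⟨s ∪ t, fun D' m hm h => ?_⟩
      obtain ⟨x', hx⟩ := hs D' m hm fun p hp => h p (Finset.mem_union_left _ hp)
      obtain ⟨y', hy⟩ := ht D' m hm fun p hp => h p (Finset.mem_union_right _ hp)
      exact ⟨x' + y', by rw [map_add, hx, hy]⟩
    · intro i x
      refine ⟨(kernelFamily i x).support, fun D' m _ h => ?_⟩
      obtain ⟨k', rfl⟩ := mem_range_imageKernelMap m i x h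
      exact ⟨(colimit.ι (kernel (imageFreeCover m)) i).hom k', colim_map_ι_apply _ _ _⟩
  obtain ⟨s, hs⟩ := hs
  obtain ⟨D', m, hm, hD', hm'⟩ := h s
  obtain ⟨k', rfl⟩ := hs D' m hm hm'
  have := imageFreeCover_epi m
  have : Projective (ShortComplex.mk _ _ (kernel.condition (imageFreeCover m))).X₂ :=
    freeDiagram_projective D _
  have hinj := map_injective_of_isZero_leftDerived_one_of_projective colim
    (kernel_ι_shortExact (imageFreeCover m)) hD'
  have hincl := colimMap_supportIncl_injective
    (M := fun _ : (Σ i, D.obj i) => ModuleCat.of R R)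
    (principalSets_monotone (imageElements m) Sigma.fst) (principalSets_monotone Set.univ Sigma.fst)
    (fun _ _ hp => ⟨trivial, hp.2⟩) (principalSets_isLocallyCodirected _ _)
  have e := ModuleCat.comp_apply_eq (f := colim.map (imageKernelMap m))
    (g := colim.map (kernel.ι (freeCover D))) (f' := colim.map (kernel.ι (imageFreeCover m)))
    (g' := colim.map (imageFreeIncl m))
    (by rw [← colim.map_comp, ← colim.map_comp, imageKernelMap_ι]) k'
  -- Acyclicity of `D'` embeds its relations in the smaller free diagram, whose colimit embeds in
  -- that of the larger one; there `k'` becomes zero.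
  have : k' = 0 := by
    refine hinj (hincl ?_)
    rw [map_zero, map_zero]
    exact e.symm.trans hk
  rw [this, map_zero]

/-- Dimension shifting moves the question to the kernel of the free cover. Finitely many relations
involve finitely many generators, so this kernel is approximated by the kernels belonging to the
subdiagrams. -/
theorem FinitelyApproximated.isZero_two {D : I ⥤ ModuleCat.{u} R}
    (h : FinitelyApproximated (fun D' => IsZero ((derivedColim I R 2).obj D')) D) :
    IsZero ((derivedColim I R 2).obj D) := by
  have : Projective (ShortComplex.mk _ _ (kernel.condition (freeCover D))).X₂ :=
    freeDiagram_projective D _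
  obtain ⟨e⟩ := leftDerived_two_iso_of_projective (F := colim) (kernel_ι_shortExact (freeCover D))
  suffices hK : IsZero ((derivedColim I R 1).obj (kernel (freeCover D))) from hK.of_iso e
  refine FinitelyApproximated.isZero_one fun s => ?_
  obtain ⟨D', m, hm, hD', hs⟩ := h (s.biUnion fun p => (kernelFamily p.1 p.2).support)
  have := imageFreeCover_epi m
  have : Projective (ShortComplex.mk _ _ (kernel.condition (imageFreeCover m))).X₂ :=
    freeDiagram_projective D _
  obtain ⟨e'⟩ := leftDerived_two_iso_of_projective (F := colim)
    (kernel_ι_shortExact (imageFreeCover m))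
  refine ⟨_, imageKernelMap m, inferInstance, hD'.of_iso e'.symm, fun p hp => ?_⟩
  exact mem_range_imageKernelMap m p.1 p.2 fun q hq =>
    hs q (Finset.mem_biUnion.2 ⟨p, hp, hq⟩)

/-! ### Acyclicity under local codirectedness -/

variable {T : Type u} (M : T → ModuleCat.{u} R) {Y : I → Set T} (hY : Monotone Y)

theorem IsLocallyCodirected.exists_le (hc : IsLocallyCodirected Y) {x : T} (hx : ∃ i, x ∈ Y i)
    (s : Finset I) (hs : ∀ i ∈ s, x ∈ Y i) : ∃ k, x ∈ Y k ∧ ∀ i ∈ s, k ≤ i := by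
  induction s using Finset.induction_on with
  | empty => exact hx.imp fun k hk => ⟨hk, by simp⟩
  | insert i s _ ih =>
    obtain ⟨k, hk, hks⟩ := ih fun j hj => hs j (Finset.mem_insert_of_mem hj)
    obtain ⟨l, hl, hl', hxl⟩ := hc i k x (hs i (Finset.mem_insert_self _ _)) hk
    refine ⟨l, hxl, fun j hj => ?_⟩
    rcases Finset.mem_insert.1 hj with rfl | hj
    · exact hl
    · exact hl'.trans (hks j hj)

/-- Only finitely many of the given families involve a point `x`. Their indices have a common lower
bound `k` with `x ∈ Y k`; declaring `x` born at `k` yields a principal subdiagram containing all of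
them. -/
theorem supportDiagram_finitelyApproximated [Nonempty I] (hc : IsLocallyCodirected Y)
    {P : (I ⥤ ModuleCat.{u} R) → Prop}
    (hP : ∀ (S : Set T) (b : T → I), P (principalDiagram M S b)) :
    FinitelyApproximated P (supportDiagram M hY) := by
  intro s
  let fam : (Σ i, (supportDiagram M hY).obj i) → ⨁ x, M x := fun p =>
    (show supportedIn M (Y p.1) from p.2).1
  have hfam : ∀ p x, x ∈ (fam p).support → x ∈ Y p.1 := fun p x hx => by
    by_contra h
    exact DFinsupp.mem_support_iff.1 hx ((show supportedIn M (Y p.1) from p.2).2 x h)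
  let S : Set T := {x | ∃ p ∈ s, x ∈ (fam p).support}
  have hb : ∀ x, ∃ k, x ∈ S → x ∈ Y k ∧ ∀ p ∈ s, x ∈ (fam p).support → k ≤ p.1 := by
    intro x
    by_cases hx : x ∈ S
    · obtain ⟨p, hp, hpx⟩ := hx
      obtain ⟨k, hk, hks⟩ := hc.exists_le ⟨p.1, hfam p x hpx⟩
        ((s.filter fun p => x ∈ (fam p).support).image Sigma.fst) (by
          intro i hi
          obtain ⟨q, hq, rfl⟩ := Finset.mem_image.1 hi
          exact hfam q x (Finset.mem_filter.1 hq).2)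
      exact ⟨k, fun _ => ⟨hk, fun q hq hqx => hks _ (Finset.mem_image_of_mem _
        (Finset.mem_filter.2 ⟨hq, hqx⟩))⟩⟩
    -- The birth index of a point outside `S` is irrelevant.
    · exact ⟨Classical.arbitrary I, fun h => absurd h hx⟩
  choose b hb using hb
  refine ⟨principalDiagram M S b, supportIncl _ _ fun i x hx => hY hx.2 (hb x hx.1).1,
    supportIncl_mono _ _ _, hP S b, fun p hp => ?_⟩
  refine ⟨(⟨fam p, fun x hx => ?_⟩ : supportedIn M (principalSets S b p.1)), rfl⟩
  by_contra h
  have h' := DFinsupp.mem_support_iff.2 h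
  exact hx ⟨⟨p, hp, h'⟩, (hb x ⟨p, hp, h'⟩).2 p hp h'⟩

theorem supportDiagram_projective_of_isEmpty [IsEmpty I] : Projective (supportDiagram M hY) :=
  (Functor.isZero _ fun i => isEmptyElim i).projective

theorem supportDiagram_isZero_one (hc : IsLocallyCodirected Y) :
    IsZero ((derivedColim I R 1).obj (supportDiagram M hY)) := by
  rcases isEmpty_or_nonempty I
  · have := supportDiagram_projective_of_isEmpty M hY
    exact Functor.isZero_leftDerived_obj_projective_succ _ 0 _
  · exact (supportDiagram_finitelyApproximated M hY hc (principalDiagram_isZero_one M)).isZero_one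

theorem supportDiagram_isZero_two (hc : IsLocallyCodirected Y) :
    IsZero ((derivedColim I R 2).obj (supportDiagram M hY)) := by
  rcases isEmpty_or_nonempty I
  · have := supportDiagram_projective_of_isEmpty M hY
    exact Functor.isZero_leftDerived_obj_projective_succ _ 1 _
  · exact (supportDiagram_finitelyApproximated M hY hc (principalDiagram_isZero_two M)).isZero_two

end Approximation

namespace DirGraph

variable {R : Type u} [Ring R] {Γ : DirGraph.{u}}

/-! ### The two-term complex of a network -/

/-- The index set of the relative `1`-chains: arrows and (external) vertices. -/
inductive RelIndex (Γ : DirGraph.{u}) : Type u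
  | arrow (a : Γ.A) : RelIndex Γ
  | ext (v : Γ.V) : RelIndex Γ

/-- The modules of the `1`-chains of the network, indexed by arrows and external vertices. -/
def Rep.relObj (F : Rep R Γ) : RelIndex Γ → ModuleCat.{u} R
  | .arrow a => F.obj (Γ.s a)
  | .ext v => F.obj v

/-- The boundary `(f, g) ↦ d f + g` of a relative `1`-chain. -/
def Rep.relBoundary (F : Rep R Γ) : (⨁ x, F.relObj x) →ₗ[R] F.Chain0 :=
  DirectSum.toModule R _ _ fun
    | .arrow a => F.d ∘ₗ DirectSum.lof R Γ.A (fun a => F.obj (Γ.s a)) a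
    | .ext v => DirectSum.lof R Γ.V (fun v => F.obj v) v

/-- The inclusion of ordinary `1`-chains into relative `1`-chains. -/
def Rep.relInl (F : Rep R Γ) : F.Chain1 →ₗ[R] ⨁ x, F.relObj x :=
  extendFamily RelIndex.arrow F.relObj

/-- The inclusion of `0`-chains into relative `1`-chains. -/
def Rep.relInr (F : Rep R Γ) : F.Chain0 →ₗ[R] ⨁ x, F.relObj x :=
  extendFamily RelIndex.ext F.relObj

variable (F : Rep R Γ)

theorem Rep.relBoundary_lof_arrow (a : Γ.A) (m : F.obj (Γ.s a)) :
    F.relBoundary (DirectSum.lof R (RelIndex Γ) (fun x => F.relObj x) (.arrow a) m) =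
      DirectSum.lof R Γ.V (fun v => F.obj v) (Γ.t a) ((F.map a).hom m)
        - DirectSum.lof R Γ.V (fun v => F.obj v) (Γ.s a) m :=
  (DirectSum.toModule_lof (M := fun x => F.relObj x) R (.arrow a) m).trans (F.d_lof a m)

theorem Rep.relBoundary_lof_ext (v : Γ.V) (m : F.obj v) :
    F.relBoundary (DirectSum.lof R (RelIndex Γ) (fun x => F.relObj x) (.ext v) m) =
      DirectSum.lof R Γ.V (fun v => F.obj v) v m :=
  DirectSum.toModule_lof (M := fun x => F.relObj x) R (.ext v) m

theorem Rep.relBoundary_relInl (f : F.Chain1) : F.relBoundary (F.relInl f) = F.d f := by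
  refine LinearMap.congr_fun (f := F.relBoundary ∘ₗ F.relInl) ?_ f
  refine DirectSum.linearMap_ext R fun a => LinearMap.ext fun m => ?_
  refine (congrArg F.relBoundary (extendFamily_lof RelIndex.arrow F.relObj a m)).trans ?_
  exact (F.relBoundary_lof_arrow a m).trans (F.d_lof a m).symm

theorem Rep.relBoundary_relInr (g : F.Chain0) : F.relBoundary (F.relInr g) = g := by
  refine LinearMap.congr_fun (f := F.relBoundary ∘ₗ F.relInr) (g := LinearMap.id) ?_ g
  refine DirectSum.linearMap_ext R fun v => LinearMap.ext fun m => ?_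
  refine (congrArg F.relBoundary (extendFamily_lof RelIndex.ext F.relObj v m)).trans ?_
  exact F.relBoundary_lof_ext v m

theorem Rep.relInl_apply_arrow (f : F.Chain1) (a : Γ.A) : F.relInl f (.arrow a) = f a :=
  extendFamily_apply (fun _ _ => RelIndex.arrow.inj) F.relObj f a

theorem Rep.relInl_apply_ext (f : F.Chain1) (v : Γ.V) : F.relInl f (.ext v) = 0 :=
  extendFamily_apply_of_not_mem (ρ := RelIndex.arrow) F.relObj f (.ext v) fun _ h => nomatch h

theorem Rep.relInr_apply_ext (g : F.Chain0) (v : Γ.V) : F.relInr g (.ext v) = g v :=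
  extendFamily_apply (fun _ _ => RelIndex.ext.inj) F.relObj g v

theorem Rep.relInr_apply_arrow (g : F.Chain0) (a : Γ.A) : F.relInr g (.arrow a) = 0 :=
  extendFamily_apply_of_not_mem (ρ := RelIndex.ext) F.relObj g (.arrow a) fun _ h => nomatch h

theorem Rep.exists_relInl_add_relInr (z : ⨁ x, F.relObj x) :
    ∃ f g, F.relInl f + F.relInr g = z := by
  induction z using DirectSum.induction_on with
  | zero => exact ⟨0, 0, by rw [map_zero, map_zero, add_zero]⟩
  | of x m =>
    rcases x with a | v
    · refine ⟨DirectSum.lof R Γ.A (fun a => F.obj (Γ.s a)) a m, 0, ?_⟩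
      rw [map_zero, add_zero]
      exact extendFamily_lof RelIndex.arrow F.relObj a m
    · refine ⟨0, DirectSum.lof R Γ.V (fun v => F.obj v) v m, ?_⟩
      rw [map_zero, zero_add]
      exact extendFamily_lof RelIndex.ext F.relObj v m
  | add x y hx hy =>
    obtain ⟨f, g, rfl⟩ := hx
    obtain ⟨f', g', rfl⟩ := hy
    exact ⟨f + f', g + g', by rw [map_add, map_add]; abel⟩

/-- The embedding `f ↦ (f, -d f)` of `1`-chains into relative `1`-cycles. -/
def Rep.relCycle : F.Chain1 →ₗ[R] ⨁ x, F.relObj x := F.relInl - F.relInr ∘ₗ F.d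

theorem Rep.relCycle_apply_arrow (f : F.Chain1) (a : Γ.A) : F.relCycle f (.arrow a) = f a := by
  refine (DirectSum.sub_apply (F.relInl f) (F.relInr (F.d f)) (.arrow a)).trans ?_
  rw [F.relInl_apply_arrow, F.relInr_apply_arrow]
  exact sub_zero _

theorem Rep.relCycle_apply_ext (f : F.Chain1) (v : Γ.V) :
    F.relCycle f (.ext v) = - F.d f v := by
  refine (DirectSum.sub_apply (F.relInl f) (F.relInr (F.d f)) (.ext v)).trans ?_
  rw [F.relInl_apply_ext, F.relInr_apply_ext]
  exact zero_sub _

theorem Rep.relCycle_injective : Function.Injective F.relCycle := fun f g h =>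
  DFinsupp.ext fun a => by
    have := DFunLike.congr_fun h (.arrow a)
    rwa [F.relCycle_apply_arrow, F.relCycle_apply_arrow] at this

theorem Rep.relBoundary_relCycle (f : F.Chain1) : F.relBoundary (F.relCycle f) = 0 := by
  refine (map_sub F.relBoundary (F.relInl f) (F.relInr (F.d f))).trans ?_
  rw [F.relBoundary_relInl, F.relBoundary_relInr, sub_self]

/-- For `z = (f, g)` the cycle condition `d f + g = 0` determines `g` from `f`. -/
theorem Rep.exists_relCycle_eq (z : ⨁ x, F.relObj x) (hz : F.relBoundary z = 0) :
    ∃ f, F.relCycle f = z := by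
  obtain ⟨f, g, rfl⟩ := F.exists_relInl_add_relInr z
  rw [map_add, F.relBoundary_relInl, F.relBoundary_relInr] at hz
  refine ⟨f, ?_⟩
  rw [eq_neg_of_add_eq_zero_right hz, map_neg, ← sub_eq_add_neg]
  rfl

/-- The indices of the relative `1`-chains with arrows in `W` and external vertices in `E`. -/
def relSupport (W : Set Γ.A) (E : Set Γ.V) : Set (RelIndex Γ)
  | .arrow a => a ∈ W
  | .ext v => v ∈ E

theorem arrow_mem_relSupport {W : Set Γ.A} {E : Set Γ.V} {a : Γ.A} :
    .arrow a ∈ relSupport W E ↔ a ∈ W := Iff.rfl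

theorem ext_mem_relSupport {W : Set Γ.A} {E : Set Γ.V} {v : Γ.V} :
    .ext v ∈ relSupport W E ↔ v ∈ E := Iff.rfl

/-- The external coordinates of `(f, -d f)` are `-d f`, so bounding their support by `E` is exactly
the Kirchhoff law off `E`. -/
theorem Rep.relCycle_mem_supportedIn_iff {W : Set Γ.A} {E : Set Γ.V} {f : F.Chain1} :
    F.relCycle f ∈ supportedIn F.relObj (relSupport W E) ↔
      f ∈ supportedIn (fun a => F.obj (Γ.s a)) W ∧ f ∈ F.flows E := by
  constructor
  · intro h
    refine ⟨fun a ha => ?_, fun v hv => ?_⟩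
    · rw [← F.relCycle_apply_arrow]
      exact h _ fun h' => ha (arrow_mem_relSupport.1 h')
    · rw [← neg_eq_zero]
      exact (F.relCycle_apply_ext f v).symm.trans (h _ fun h' => hv (ext_mem_relSupport.1 h'))
  · rintro ⟨h, h'⟩ (a | v) hx
    · rw [F.relCycle_apply_arrow]
      exact h a fun ha => hx (arrow_mem_relSupport.2 ha)
    · rw [F.relCycle_apply_ext]
      exact neg_eq_zero.2 (h' v fun hv => hx (ext_mem_relSupport.2 hv))

theorem exists_extendFamily_eq {κ : Type u} (M : κ → ModuleCat.{u} R) (s : Set κ) {z : ⨁ k, M k}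
    (hz : z ∈ supportedIn M s) : ∃ y, extendFamily (fun k : s => k.1) M y = z := by
  refine supportedIn_induction (p := fun z => ∃ y, extendFamily (fun k : s => k.1) M y = z)
    ⟨0, map_zero _⟩ ?_ ?_ hz
  · rintro _ _ ⟨x, rfl⟩ ⟨y, rfl⟩
    exact ⟨x + y, map_add _ _ _⟩
  · intro x hx m
    exact ⟨_, extendFamily_lof (fun k : s => k.1) M ⟨x, hx⟩ m⟩

theorem Rep.chainIncl_injective (H : Γ.Sub) : Function.Injective (F.chainIncl H) := fun f g h =>
  DFinsupp.ext fun a => by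
    have e := DFunLike.congr_fun h a.1
    exact (extendFamily_apply Subtype.val_injective (fun a => F.obj (Γ.s a)) f a).symm.trans
      (e.trans (extendFamily_apply Subtype.val_injective (fun a => F.obj (Γ.s a)) g a))

theorem Rep.chainIncl_mem_supportedIn (H : Γ.Sub) (f : (F.restrict H).Chain1) :
    F.chainIncl H f ∈ supportedIn (fun a => F.obj (Γ.s a)) H.arrows := fun a ha =>
  extendFamily_apply_of_not_mem (ρ := fun a : H.arrows => a.1) (fun a => F.obj (Γ.s a)) f a
    fun b hb => ha (hb ▸ b.2)

theorem Rep.mem_flows_of_chainIncl_mem (H : Γ.Sub) {E : Set Γ.V} {f : (F.restrict H).Chain1}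
    (hf : F.chainIncl H f ∈ F.flows E) : f ∈ (F.restrict H).flows (H.external E) := by
  intro v hv
  have h := hf v.1 hv
  have h' : F.d (F.chainIncl H f) = F.vertexIncl H ((F.restrict H).d f) :=
    LinearMap.congr_fun (F.d_chainIncl H) f
  rw [h'] at h
  exact (extendFamily_apply Subtype.val_injective (fun v => F.obj v) ((F.restrict H).d f)
    v).symm.trans h

/-- The relative boundaries of the relative `1`-chains supported on a subnetwork. -/
def Rep.boundaries (W : Set Γ.A) (E : Set Γ.V) : Submodule R F.Chain0 :=
  (supportedIn F.relObj (relSupport W E)).map F.relBoundary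

theorem Rep.relBoundary_mem_boundaries {W : Set Γ.A} {E : Set Γ.V} {z : ⨁ x, F.relObj x}
    (hz : z ∈ supportedIn F.relObj (relSupport W E)) : F.relBoundary z ∈ F.boundaries W E :=
  Submodule.mem_map_of_mem hz

theorem Rep.boundaries_le (H : Γ.Sub) {E : Set Γ.V} (hE : E ⊆ H.verts) :
    F.boundaries H.arrows E ≤ supportedIn F.obj H.verts := by
  rintro _ ⟨z, hz, rfl⟩
  refine supportedIn_induction (p := fun z => F.relBoundary z ∈ supportedIn F.obj H.verts)
    ?_ ?_ ?_ hz
  · rw [map_zero]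
    exact zero_mem _
  · intro x y hx hy
    rw [map_add]
    exact add_mem hx hy
  · rintro (a | v) hx m
    · refine Set.mem_of_eq_of_mem (F.relBoundary_lof_arrow a m) ?_
      have ha := arrow_mem_relSupport.1 hx
      exact sub_mem (lof_mem_supportedIn (H.t_mem a ha) _) (lof_mem_supportedIn (H.s_mem a ha) _)
    · refine Set.mem_of_eq_of_mem (F.relBoundary_lof_ext v m) ?_
      exact lof_mem_supportedIn (hE (ext_mem_relSupport.1 hx)) _

/-! ### Obstructions as a quotient of `0`-chains -/

variable (H : Γ.Sub) (E : Set Γ.V)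

/-- The structural map from a vertex of a subgraph to the module of obstructions. -/
def Rep.vertexToObstruction (v : Γ.V) (hv : v ∈ H.verts) :
    F.obj v →ₗ[R] (F.restrict H).obstruction (H.external E) :=
  (((F.restrict H).coneOff (H.external E)).toObstruction₀ (some ⟨v, hv⟩)).hom

/-- The projection from `0`-chains to obstructions (zero away from the subgraph). -/
def Rep.toObstruction : F.Chain0 →ₗ[R] (F.restrict H).obstruction (H.external E) :=
  DirectSum.toModule R _ _ fun v =>
    if h : v ∈ H.verts then F.vertexToObstruction H E v h else 0

theorem Rep.toObstruction_lof (v : Γ.V) (hv : v ∈ H.verts) (m : F.obj v) :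
    F.toObstruction H E (DirectSum.lof R Γ.V (fun v => F.obj v) v m) =
      F.vertexToObstruction H E v hv m := by
  refine (DirectSum.toModule_lof (M := fun v => F.obj v) R v m).trans ?_
  rw [dif_pos hv]

/-- On arrows this is compatibility of the cocone. At an external vertex the structural map factors
through the zero module at the cone point. -/
theorem Rep.toObstruction_boundary (z : ⨁ x, F.relObj x)
    (hz : z ∈ supportedIn F.relObj (relSupport H.arrows (H.verts ∩ E))) :
    F.toObstruction H E (F.relBoundary z) = 0 := by
  refine supportedIn_induction (p := fun z => F.toObstruction H E (F.relBoundary z) = 0)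
    ?_ ?_ ?_ hz
  · rw [map_zero, map_zero]
  · intro x y hx hy
    rw [map_add, map_add, hx, hy, add_zero]
  · rintro (a | v) hx m
    · have ha := arrow_mem_relSupport.1 hx
      change F.obj (Γ.s a) at m
      refine (congrArg (F.toObstruction H E) (F.relBoundary_lof_arrow a m)).trans ?_
      rw [map_sub, F.toObstruction_lof H E _ (H.t_mem a ha),
        F.toObstruction_lof H E _ (H.s_mem a ha), sub_eq_zero]
      exact LinearMap.congr_fun (congrArg ModuleCat.Hom.hom
        (((F.restrict H).coneOff (H.external E)).map_toObstruction₀ (.inl ⟨a, ha⟩))) m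
    · have hv := ext_mem_relSupport.1 hx
      change F.obj v at m
      refine (congrArg (F.toObstruction H E) (F.relBoundary_lof_ext v m)).trans ?_
      rw [F.toObstruction_lof H E _ hv.1]
      refine (LinearMap.congr_fun (congrArg ModuleCat.Hom.hom
        (((F.restrict H).coneOff (H.external E)).map_toObstruction₀
          (.inr ⟨⟨v, hv.1⟩, hv.2⟩))) m).symm.trans ?_
      exact map_zero (((F.restrict H).coneOff (H.external E)).toObstruction₀ none).hom

theorem Rep.exists_toObstruction_eq (o : (F.restrict H).obstruction (H.external E)) :
    ∃ z ∈ supportedIn F.obj H.verts, F.toObstruction H E z = o := by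
  refine colimit_induction (p := fun o => ∃ z ∈ supportedIn F.obj H.verts,
    F.toObstruction H E z = o) ⟨0, zero_mem _, map_zero _⟩ ?_ ?_ o
  · rintro _ _ ⟨x, hx, rfl⟩ ⟨y, hy, rfl⟩
    exact ⟨x + y, add_mem hx hy, map_add _ _ _⟩
  · rintro (_ | v) m
    · refine ⟨0, zero_mem _, (map_zero _).trans ?_⟩
      have : m = 0 := Subsingleton.elim (α := PUnit) _ _
      rw [this]
      exact (map_zero _).symm
    · exact ⟨_, lof_mem_supportedIn v.2 m, F.toObstruction_lof H E v.1 v.2 m⟩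

/-- The components of the inverse of the isomorphism of obstructions with the cokernel. -/
def Rep.obstructionToQuotientLeg (W : Set Γ.A) :
    ∀ v : ((H.graph).coneOff (H.external E)).V,
      ((F.restrict H).coneOff (H.external E)).obj v ⟶
        ModuleCat.of R (F.Chain0 ⧸ F.boundaries W (H.verts ∩ E))
  | some v => ModuleCat.ofHom ((F.boundaries W (H.verts ∩ E)).mkQ ∘ₗ
      DirectSum.lof R Γ.V (fun v => F.obj v) v.1)
  | none => 0

theorem Rep.mkQ_boundaries_arrow {W : Set Γ.A} {E : Set Γ.V} {a : Γ.A} (ha : a ∈ W)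
    (m : F.obj (Γ.s a)) : (F.boundaries W E).mkQ
        (DirectSum.lof R Γ.V (fun v => F.obj v) (Γ.t a) ((F.map a).hom m)) =
      (F.boundaries W E).mkQ (DirectSum.lof R Γ.V (fun v => F.obj v) (Γ.s a) m) := by
  have h := F.relBoundary_mem_boundaries (lof_mem_supportedIn (M := F.relObj)
    (s := relSupport W E) (x := .arrow a) ha m)
  exact (Submodule.Quotient.eq _).2 (Set.mem_of_eq_of_mem (F.relBoundary_lof_arrow a m).symm h)

theorem Rep.mkQ_boundaries_ext {W : Set Γ.A} {E : Set Γ.V} {v : Γ.V} (hv : v ∈ E) (m : F.obj v) :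
    (F.boundaries W E).mkQ (DirectSum.lof R Γ.V (fun v => F.obj v) v m) = 0 := by
  have h := F.relBoundary_mem_boundaries (lof_mem_supportedIn (M := F.relObj)
    (s := relSupport W E) (x := .ext v) hv m)
  exact (Submodule.Quotient.mk_eq_zero _).2
    (Set.mem_of_eq_of_mem (F.relBoundary_lof_ext v m).symm h)

/-- The map from obstructions to the quotient of `0`-chains by relative boundaries. -/
def Rep.obstructionToQuotient : (F.restrict H).obstruction (H.external E) ⟶
    ModuleCat.of R (F.Chain0 ⧸ F.boundaries H.arrows (H.verts ∩ E)) :=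
  ((F.restrict H).coneOff (H.external E)).obstruction₀Desc
    (F.obstructionToQuotientLeg H E H.arrows) <| by
    rintro (a | e)
    · exact ModuleCat.hom_ext (LinearMap.ext fun m => F.mkQ_boundaries_arrow a.2 m)
    · exact ModuleCat.hom_ext (LinearMap.ext fun m =>
        (F.mkQ_boundaries_ext (W := H.arrows) (E := H.verts ∩ E) ⟨e.1.2, e.2⟩ m).symm)

/-- The universal property of the colimit gives a map back to chains modulo boundaries; on chains
supported in `H`, the composite is the quotient map. -/
theorem Rep.mem_boundaries_of_toObstruction_eq_zero {z : F.Chain0}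
    (hz : z ∈ supportedIn F.obj H.verts) (h : F.toObstruction H E z = 0) :
    z ∈ F.boundaries H.arrows (H.verts ∩ E) := by
  have e : (F.obstructionToQuotient H E).hom (F.toObstruction H E z) =
      (F.boundaries H.arrows (H.verts ∩ E)).mkQ z := by
    refine supportedIn_induction (p := fun z =>
      (F.obstructionToQuotient H E).hom (F.toObstruction H E z) =
        (F.boundaries H.arrows (H.verts ∩ E)).mkQ z) ?_ ?_ ?_ hz
    · rw [map_zero, map_zero, map_zero]
    · intro x y hx hy
      rw [map_add, map_add, map_add, hx, hy]
    · intro v hv m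
      rw [F.toObstruction_lof H E v hv]
      exact LinearMap.congr_fun (congrArg ModuleCat.Hom.hom (Rep.toObstruction₀_desc
        ((F.restrict H).coneOff (H.external E)) _ _ (some ⟨v, hv⟩))) m
  rw [h, map_zero] at e
  exact (Submodule.Quotient.mk_eq_zero _).1 e.symm

end DirGraph

/-! ### The exact sequence of a locally filtered cover -/

theorem DirGraph.IsLocallyFilteredCovering.isLocallyCodirected {I : Type u} [PartialOrder I]
    {T : Type u} {X : Set T} {Y : I → Set T} (h : DirGraph.IsLocallyFilteredCovering X Y) :
    IsLocallyCodirected Y := fun i j x hi hj => by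
  obtain ⟨k, hk, hk', hx, -⟩ := h.exists_le i j x ⟨hi, hj⟩
  exact ⟨k, hk, hk', hx⟩

namespace DirGraph.LocallyFilteredCover

variable {R : Type u} [Ring R] {Γ : DirGraph.{u}} {I : Type u} [PartialOrder I] {E : Set Γ.V}
  (𝒞 : LocallyFilteredCover Γ E I) (F : Rep R Γ)

/-- The indices of the relative `1`-chains of the members of the cover. -/
def relSets (i : I) : Set (RelIndex Γ) := relSupport (𝒞.sub i).arrows (𝒞.external i)

theorem relSets_monotone : Monotone 𝒞.relSets := fun i j h x => by
  rcases x with a | v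
  · exact fun ha => 𝒞.arrows_cover.mono i j h ha
  · exact fun hv => 𝒞.external_cover.mono i j h hv

theorem relSets_isLocallyCodirected : IsLocallyCodirected 𝒞.relSets := fun i j x => by
  rcases x with a | v
  · exact fun hi hj => 𝒞.arrows_cover.isLocallyCodirected i j a hi hj
  · exact fun hi hj => 𝒞.external_cover.isLocallyCodirected i j v hi hj

theorem iUnion_relSets : ⋃ i, 𝒞.relSets i = relSupport Set.univ E := by
  ext (a | v)
  · have h := Set.ext_iff.1 𝒞.arrows_cover.iUnion_eq a
    rw [Set.mem_iUnion] at h ⊢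
    exact h.symm
  · have h := Set.ext_iff.1 𝒞.external_cover.iUnion_eq v
    rw [Set.mem_iUnion] at h ⊢
    exact h.symm

theorem verts_monotone : Monotone fun i => (𝒞.sub i).verts := 𝒞.verts_cover.mono

/-- The diagram of relative `1`-chains. -/
abbrev chain1Diagram : I ⥤ ModuleCat.{u} R := supportDiagram F.relObj 𝒞.relSets_monotone

/-- The diagram of `0`-chains. -/
abbrev chain0Diagram : I ⥤ ModuleCat.{u} R := supportDiagram F.obj 𝒞.verts_monotone

theorem boundaries_mono {i j : I} (h : i ≤ j) :
    F.boundaries (𝒞.sub i).arrows (𝒞.external i) ≤ F.boundaries (𝒞.sub j).arrows (𝒞.external j) :=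
  Submodule.map_mono (supportedIn_mono (𝒞.relSets_monotone h))

/-- The diagram of relative boundaries. -/
def boundaryDiagram : I ⥤ ModuleCat.{u} R where
  obj i := ModuleCat.of R (F.boundaries (𝒞.sub i).arrows (𝒞.external i))
  map h := ModuleCat.ofHom (Submodule.inclusion (𝒞.boundaries_mono F h.le))

/-- Flows as relative `1`-cycles. -/
def flowsToChain1 : 𝒞.flowsDiagram F ⟶ 𝒞.chain1Diagram F where
  app i := ModuleCat.ofHom <| ((F.relCycle ∘ₗ F.chainIncl (𝒞.sub i)).domRestrict
    ((F.restrict (𝒞.sub i)).flows ((𝒞.sub i).external (𝒞.external i)))).codRestrict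
      (supportedIn F.relObj (𝒞.relSets i)) fun f =>
        F.relCycle_mem_supportedIn_iff.2 ⟨F.chainIncl_mem_supportedIn _ _,
          F.chainIncl_mem_flows subset_rfl f.1 f.2⟩
  naturality {i j} h := by
    refine ModuleCat.hom_ext (LinearMap.ext fun f => Subtype.ext (congrArg F.relCycle ?_))
    exact extendFamily_comp
      (fun a : (𝒞.sub i).arrows =>
        (⟨a.1, 𝒞.arrows_cover.mono i j h.le a.2⟩ : (𝒞.sub j).arrows))
      (fun a : (𝒞.sub j).arrows => a.1) (fun a => F.obj (Γ.s a)) f.1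

/-- The relative boundary. -/
def chain1ToBoundary : 𝒞.chain1Diagram F ⟶ 𝒞.boundaryDiagram F where
  app i := ModuleCat.ofHom <| F.relBoundary.restrict
    (p := supportedIn F.relObj (𝒞.relSets i)) fun _ hz => F.relBoundary_mem_boundaries hz

/-- The inclusion of relative boundaries into `0`-chains. -/
def boundaryToChain0 : 𝒞.boundaryDiagram F ⟶ 𝒞.chain0Diagram F where
  app i := ModuleCat.ofHom (Submodule.inclusion
    (F.boundaries_le (𝒞.sub i) (𝒞.external_subset i)))

/-- The projection from `0`-chains to obstructions. -/
def chain0ToObstruction : 𝒞.chain0Diagram F ⟶ 𝒞.obstructionDiagram F where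
  app i := ModuleCat.ofHom (F.toObstruction (𝒞.sub i) (𝒞.external i) ∘ₗ
    (supportedIn F.obj (𝒞.sub i).verts).subtype)
  naturality {i j} h := by
    refine ModuleCat.hom_ext (supportedIn_hom_ext fun v hv m => ?_)
    have hv' := 𝒞.verts_monotone h.le hv
    refine (F.toObstruction_lof (𝒞.sub j) (𝒞.external j) v hv' m).trans ?_
    refine Eq.trans ?_ (congrArg _ (F.toObstruction_lof (𝒞.sub i) (𝒞.external i) v hv m)).symm
    exact (LinearMap.congr_fun (congrArg ModuleCat.Hom.hom (F.toObstruction₀_obstructionMap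
      (𝒞.verts_cover.mono i j h.le) (𝒞.arrows_cover.mono i j h.le)
      (𝒞.external_cover.mono i j h.le) (some ⟨v, hv⟩))) m).symm

theorem flows_shortExact : ∃ w,
    (ShortComplex.mk (𝒞.flowsToChain1 F) (𝒞.chain1ToBoundary F) w).ShortExact := by
  refine ⟨?_, shortExact_of_eval ?_ ?_ ?_⟩
  · exact NatTrans.ext (funext fun i => ModuleCat.hom_ext (LinearMap.ext fun f =>
      Subtype.ext (F.relBoundary_relCycle _)))
  · intro i f g h
    exact Subtype.ext (F.chainIncl_injective _ (F.relCycle_injective (congrArg Subtype.val h)))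
  · rintro i ⟨z, hz⟩ h
    obtain ⟨f, rfl⟩ := F.exists_relCycle_eq z (congrArg Subtype.val h)
    obtain ⟨hf, hf'⟩ := F.relCycle_mem_supportedIn_iff.1 hz
    obtain ⟨f, rfl⟩ := exists_extendFamily_eq (fun a => F.obj (Γ.s a)) _ hf
    exact ⟨⟨f, F.mem_flows_of_chainIncl_mem _ hf'⟩, rfl⟩
  · rintro i ⟨_, z, hz, rfl⟩
    exact ⟨⟨z, hz⟩, rfl⟩

theorem obstruction_shortExact : ∃ w,
    (ShortComplex.mk (𝒞.boundaryToChain0 F) (𝒞.chain0ToObstruction F) w).ShortExact := by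
  -- The obstructions of a subgraph see only the external vertices lying in it, which here are all
  -- of `E_i`.
  have hE : ∀ i, (𝒞.sub i).verts ∩ 𝒞.external i = 𝒞.external i := fun i =>
    Set.inter_eq_right.2 (𝒞.external_subset i)
  refine ⟨?_, shortExact_of_eval ?_ ?_ ?_⟩
  · refine NatTrans.ext (funext fun i => ModuleCat.hom_ext (LinearMap.ext ?_))
    rintro ⟨_, z, hz, rfl⟩
    exact F.toObstruction_boundary (𝒞.sub i) (𝒞.external i) z (by rwa [hE i])
  · exact fun i => Submodule.inclusion_injective
      (F.boundaries_le (𝒞.sub i) (𝒞.external_subset i))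
  · rintro i ⟨z, hz⟩ h
    have hz' := F.mem_boundaries_of_toObstruction_eq_zero (𝒞.sub i) (𝒞.external i) hz h
    rw [hE i] at hz'
    exact ⟨⟨z, hz'⟩, rfl⟩
  · intro i o
    obtain ⟨z, hz, hzo⟩ := F.exists_toObstruction_eq (𝒞.sub i) (𝒞.external i) o
    exact ⟨⟨z, hz⟩, hzo⟩

/-- This ties the canonical map to `colim Φ → colim C₁`, both read in the global relative chains, so
that right exactness of the colimit applies to it. -/
theorem relCycle_flowsColimitMap (c : ↑(colimit (𝒞.flowsDiagram F))) :
    F.relCycle ((show F.flows E from (𝒞.flowsColimitMap F).hom c).1) =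
      (supportColimitMap F.relObj 𝒞.relSets_monotone).hom
        ((colim.map (𝒞.flowsToChain1 F)).hom c) := by
  let J : ModuleCat.of R (F.flows E) ⟶ ModuleCat.of R (⨁ x, F.relObj x) :=
    ModuleCat.ofHom (F.relCycle ∘ₗ (F.flows E).subtype)
  have h : 𝒞.flowsColimitMap F ≫ J =
      colim.map (𝒞.flowsToChain1 F) ≫ supportColimitMap F.relObj 𝒞.relSets_monotone := by
    refine colimit.hom_ext fun i => ModuleCat.hom_ext (LinearMap.ext fun f => ?_)
    have h1 := LinearMap.congr_fun (congrArg ModuleCat.Hom.hom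
      (colimit.ι_desc (𝒞.flowsCocone F) i)) f
    have h2 := colim_map_ι_apply (𝒞.flowsToChain1 F) i f
    have h3 := supportColimitMap_ι F.relObj 𝒞.relSets_monotone i
      (((𝒞.flowsToChain1 F).app i).hom f)
    refine (congrArg J.hom h1).trans (Eq.trans ?_ (congrArg
      (supportColimitMap F.relObj 𝒞.relSets_monotone).hom h2).symm)
    exact h3.symm
  exact ModuleCat.comp_apply_eq h c

theorem supportColimitMap_boundary (c : ↑(colimit (𝒞.chain1Diagram F))) :
    (supportColimitMap F.obj 𝒞.verts_monotone).hom
        ((colim.map (𝒞.boundaryToChain0 F)).hom ((colim.map (𝒞.chain1ToBoundary F)).hom c)) =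
      F.relBoundary ((supportColimitMap F.relObj 𝒞.relSets_monotone).hom c) := by
  refine colimit_induction (p := fun c => (supportColimitMap F.obj 𝒞.verts_monotone).hom
      ((colim.map (𝒞.boundaryToChain0 F)).hom ((colim.map (𝒞.chain1ToBoundary F)).hom c)) =
    F.relBoundary ((supportColimitMap F.relObj 𝒞.relSets_monotone).hom c)) ?_ ?_ ?_ c
  · simp only [map_zero]
  · intro a b ha hb
    simp only [map_add, ha, hb]
  · intro i f
    rw [colim_map_ι_apply, colim_map_ι_apply]
    refine (supportColimitMap_ι F.obj 𝒞.verts_monotone i _).trans ?_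
    exact (congrArg F.relBoundary (supportColimitMap_ι F.relObj 𝒞.relSets_monotone i f)).symm

theorem relCycle_mem_range (f : F.flows E) :
    ∃ c, (supportColimitMap F.relObj 𝒞.relSets_monotone).hom c = F.relCycle f.1 := by
  refine mem_range_supportColimitMap F.relObj 𝒞.relSets_monotone ?_
  rw [𝒞.iUnion_relSets]
  exact F.relCycle_mem_supportedIn_iff.2 ⟨fun a ha => absurd trivial ha, f.2⟩

/-- Since `colim C₀` embeds in the global `0`-chains, the condition says that the global relative
boundary of `c` is zero, that is, `c` has the form `(f, -d f)`. -/
theorem boundary_eq_zero_iff (c : ↑(colimit (𝒞.chain1Diagram F))) :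
    (colim.map (𝒞.boundaryToChain0 F)).hom ((colim.map (𝒞.chain1ToBoundary F)).hom c) = 0 ↔
      ∃ f : F.flows E,
        F.relCycle f.1 = (supportColimitMap F.relObj 𝒞.relSets_monotone).hom c := by
  have hinj := supportColimitMap_injective F.obj 𝒞.verts_monotone
    𝒞.verts_cover.isLocallyCodirected
  rw [← hinj.eq_iff, 𝒞.supportColimitMap_boundary, map_zero]
  constructor
  · intro h
    obtain ⟨f, hf⟩ := F.exists_relCycle_eq _ h
    -- External coordinates of elements of the colimit lie in `E`; this forces the Kirchhoff law on
    -- `f`.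
    have hc : (supportColimitMap F.relObj 𝒞.relSets_monotone).hom c ∈
        supportedIn F.relObj (relSupport Set.univ E) := by
      refine colimit_induction (p := fun c => (supportColimitMap F.relObj 𝒞.relSets_monotone).hom c
        ∈ supportedIn F.relObj (relSupport Set.univ E)) ?_ ?_ ?_ c
      · rw [map_zero]
        exact zero_mem _
      · intro a b ha hb
        rw [map_add]
        exact add_mem ha hb
      · rintro i ⟨z, hz⟩
        refine Set.mem_of_eq_of_mem (supportColimitMap_ι F.relObj 𝒞.relSets_monotone i ⟨z, hz⟩) ?_
        rw [← 𝒞.iUnion_relSets]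
        exact supportedIn_mono (Set.subset_iUnion 𝒞.relSets i) hz
    rw [← hf] at hc
    exact ⟨⟨f, (F.relCycle_mem_supportedIn_iff.1 hc).2⟩, hf⟩
  · rintro ⟨f, hf⟩
    rw [← hf, F.relBoundary_relCycle]

end DirGraph.LocallyFilteredCover

/-- The connecting homomorphism obtained by lifting along `s`, projecting along `g` and lifting
along `ι`. -/
theorem exists_connecting_hom {R : Type*} [Ring R] {K P C B D X L : Type*}
    [AddCommGroup K] [AddCommGroup P] [AddCommGroup C] [AddCommGroup B] [AddCommGroup D]
    [AddCommGroup X] [AddCommGroup L] [Module R K] [Module R P] [Module R C] [Module R B]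
    [Module R D] [Module R X] [Module R L]
    (k : K →ₗ[R] C) (g : C →ₗ[R] B) (b : B →ₗ[R] D) (ι : L →ₗ[R] B) (s : C →ₗ[R] X)
    (J : P →ₗ[R] X) (u : K →ₗ[R] P) (hkg : Function.Exact k g) (hg : Function.Surjective g)
    (hι : Function.Injective ι) (hιb : Function.Exact ι b) (hs : Function.Injective s)
    (hJ : Function.Injective J) (hu : ∀ x, J (u x) = s (k x)) (hJs : ∀ x, ∃ c, s c = J x)
    (hb : ∀ c, b (g c) = 0 ↔ ∃ x, J x = s c) :
    ∃ δ : P →ₗ[R] L, Function.Exact u δ ∧ Function.Surjective δ := by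
  -- `σ` reads an element of `P` as an element of `C` inside the common ambient module `X`.
  let σ : P →ₗ[R] C := (LinearEquiv.ofInjective s hs).symm.toLinearMap ∘ₗ
    J.codRestrict (LinearMap.range s) hJs
  have hσ : ∀ x, s (σ x) = J x := fun x =>
    congrArg Subtype.val ((LinearEquiv.ofInjective s hs).apply_symm_apply _)
  -- By `hb`, `b` kills `g (σ x)`, so exactness puts it in the range of `ι`.
  let δ : P →ₗ[R] L := (LinearEquiv.ofInjective ι hι).symm.toLinearMap ∘ₗ
    (g ∘ₗ σ).codRestrict (LinearMap.range ι) fun x =>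
      (hιb _).1 ((hb _).2 ⟨x, (hσ x).symm⟩)
  have hδ : ∀ x, ι (δ x) = g (σ x) := fun x =>
    congrArg Subtype.val ((LinearEquiv.ofInjective ι hι).apply_symm_apply _)
  refine ⟨δ, fun x => ?_, fun l => ?_⟩
  · rw [← hι.eq_iff, hδ, map_zero, hkg]
    constructor
    · rintro ⟨y, hy⟩
      exact ⟨y, hJ (by rw [hu, hy, hσ])⟩
    · rintro ⟨y, rfl⟩
      exact ⟨y, hs (by rw [hσ, hu])⟩
  · obtain ⟨c, hc⟩ := hg (ι l)
    obtain ⟨x, hx⟩ := (hb c).1 (by rw [hc, hιb.apply_apply_eq_zero])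
    refine ⟨x, hι ?_⟩
    rw [hδ, ← hc, hs ((hσ x).trans hx)]

end

/-! ### Assembly of the exact sequence -/

theorem mainTheorem3 {R : Type u} [Ring R] {I : Type u} [PartialOrder I] (Γ : DirGraph.{u})
    (E : Set Γ.V) (𝒞 : DirGraph.LocallyFilteredCover Γ E I) (F : DirGraph.Rep R Γ) :
    ∃ (α : (derivedColim I R 2).obj (𝒞.obstructionDiagram F) ⟶ colimit (𝒞.flowsDiagram F))
      (δ : ModuleCat.of R (F.flows E) ⟶ (derivedColim I R 1).obj (𝒞.obstructionDiagram F)),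
      Function.Injective α.hom ∧
      Function.Exact α.hom (𝒞.flowsColimitMap F).hom ∧
      Function.Exact (𝒞.flowsColimitMap F).hom δ.hom ∧
      Function.Surjective δ.hom := by
  obtain ⟨w₁, h₁⟩ := 𝒞.flows_shortExact F
  obtain ⟨w₂, h₂⟩ := 𝒞.obstruction_shortExact F
  have hC₁ := supportDiagram_isZero_one F.relObj 𝒞.relSets_monotone 𝒞.relSets_isLocallyCodirected
  have hC₀ := supportDiagram_isZero_one F.obj 𝒞.verts_monotone 𝒞.verts_cover.isLocallyCodirected
  have hC₀' := supportDiagram_isZero_two F.obj 𝒞.verts_monotone 𝒞.verts_cover.isLocallyCodirected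
  obtain ⟨e⟩ := leftDerived_two_iso (F := colim) h₂ hC₀ hC₀'
  obtain ⟨κ, hκ, hκ'⟩ := leftDerived_one_exact colim h₁ hC₁
  obtain ⟨ι, hι, hι'⟩ := leftDerived_one_exact colim h₂ hC₀
  have hs := supportColimitMap_injective F.relObj 𝒞.relSets_monotone 𝒞.relSets_isLocallyCodirected
  have hu := 𝒞.relCycle_flowsColimitMap F
  have hJ : Function.Injective (F.relCycle ∘ₗ (F.flows E).subtype) :=
    F.relCycle_injective.comp Subtype.val_injective
  obtain ⟨δ, hδ, hδ'⟩ := exists_connecting_hom (colim.map (𝒞.flowsToChain1 F)).hom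
    (colim.map (𝒞.chain1ToBoundary F)).hom (colim.map (𝒞.boundaryToChain0 F)).hom ι.hom
    (supportColimitMap F.relObj 𝒞.relSets_monotone).hom
    (F.relCycle ∘ₗ (F.flows E).subtype) (𝒞.flowsColimitMap F).hom
    (colim.map_exact_of_shortExact h₁) (colim.map_surjective_of_shortExact h₁) hι hι' hs hJ hu
    (𝒞.relCycle_mem_range F) (𝒞.boundary_eq_zero_iff F)
  -- The first map is the composite `colim_2 Φ₀ ≅ colim_1 B → colim Φ`.
  refine ⟨e.hom ≫ κ, ModuleCat.ofHom δ, ?_, fun c => ?_, hδ, hδ'⟩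
  · exact hκ.comp ((ModuleCat.mono_iff_injective e.hom).1 inferInstance)
  -- Both targets embed in the global relative chains, where the two images of `c` coincide; so the
  -- canonical map and `colim Φ → colim C₁` have the same kernel.
  · have h0 : (𝒞.flowsColimitMap F).hom c = 0 ↔ (colim.map (𝒞.flowsToChain1 F)).hom c = 0 := by
      rw [← hJ.eq_iff, ← hs.eq_iff, map_zero, map_zero]
      exact Eq.congr (hu c) rfl
    rw [h0]
    refine (hκ' c).trans ⟨?_, ?_⟩
    · rintro ⟨y, rfl⟩
      obtain ⟨x, rfl⟩ := (ModuleCat.epi_iff_surjective e.hom).1 inferInstance y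
      exact ⟨x, rfl⟩
    · rintro ⟨x, rfl⟩
      exact ⟨e.hom.hom x, rfl⟩
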